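/- **Setting.** Let $\mathcal L$ be a twisted affine Lie superalgebra with nonzero odd part, of type $A(2k,2\ell-1)^{(2)}$, $A(2k-1,2\ell-1)^{(2)}$ (with $k\ge 1$, $(k,\ell)\neq(1,1)$), $A(2k,2\ell)^{(4)}$ or $D(k+1,\ell)^{(2)}$, where $k\ge 0$, $\ell\ge 1$. That is, $\mathfrak g$ is the complex basic classical simple Lie superalgebra of type $A$ or $D$ given by $\mathfrak{sl}(2k+1|2\ell)$, $\mathfrak{sl}(2k|2\ell)$, $\mathfrak{sl}(2k+1|2\ell+1)$ (each modulo its scalar matrices) or $\mathfrak{osp}(2k+2|2\ell)$ respectively, with Cartan subalgebra $\mathfrak h$ the diagonal matrices and supertrace form $\kappa$; $\sigma$ is its standard diagram automorphism, of order $n=2,2,4,2$ respectively, i.e. minus the superadjoint with respect to an even bilinear form (symmetric on the even part and, on the odd part, alternating on $\mathbb C^{2\ell}$ and, in the third case, orthogonally extended by a one-dimensional symmetric form) in the first three cases, and conjugation by a reflection of $\mathbb C^{2k+2}$ (exchanging the two vectors of a hyperbolic pair of weight vectors) in the last. With $\mathfrak g_{[j]}$ the $e^{2\pi i j/n}$-eigenspace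 of $\sigma$, $$\mathcal L=\bigoplus_{j=0}^{n-1}\mathfrak g_{[j]}\otimes t^j\mathbb C[t^{\pm n}]\oplus\mathbb Cc\oplus\mathbb Cd,\qquad \mathcal H=(\mathfrak g_{[0]}\cap\mathfrak h)\otimes 1\oplus\mathbb Cc\oplus\mathbb Cd,$$ $$[x\otimes t^p+rc+sd,\;y\otimes t^q+r'c+s'd]=[x,y]\otimes t^{p+q}+p\,\kappa(x,y)\delta_{p+q,0}c+sq\,y\otimes t^q-s'p\,x\otimes t^p .$$ Let $(\cdot,\cdot)$ be the form on $\mathcal H^*$ transferred from the form $(x\otimes t^p+rc+sd,\,y\otimes t^q+r'c+s'd)=\kappa(x,y)\delta_{p+q,0}+rs'+sr'$. Let $R\ni 0$ be the root system of $\mathcal L$ with respect to $\mathcal H$, with root spaces $\mathcal L^\alpha$; let $R_0$ be the root system of the even part $\mathcal L_0$; put $R_{re}^\times=\{\alpha\in R: (\alpha,\alpha)\ne 0\}$ and $R_{re}=\{0\}\cup R_{re}^\times$. Let $\delta\in\mathcal H^*$ satisfy $\delta(d)=1$ and vanish on $(\mathfrak g_{[0]}\cap\mathfrak h)\otimes1\oplus\mathbb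 Cc$. Let $\dot R$ be the set of $\dot\gamma\in\mathcal H^*$ with $\dot\gamma(d)=0$ and $(\dot\gamma+\mathbb Z\delta)\cap R\neq\emptyset$, and $\dot R_{re}$ the set consisting of $0$ and those $\dot\gamma\in\dot R$ with $(\dot\gamma+\mathbb Z\delta)\cap R\subseteq R_{re}$. Let $M$ be a finite weight $\mathcal L$-module, i.e. $M=\bigoplus_{\lambda\in\mathcal H^*}M^\lambda$ with every weight space $M^\lambda$ finite-dimensional, and let $\mathrm{supp}(M)=\{\lambda: M^\lambda\neq 0\}$. Let $R^{in}$ (resp. $R^{ln}$) be the set of $\alpha\in R_{re}^\times$ such that nonzero elements of $\mathcal L^\alpha$ act injectively (resp. locally nilpotently) on $M$. Assume that $M$ has shadow: $R_{re}^\times=R^{in}\cup R^{ln}$, $R^{ln}=\mathfrak B_M\cap R_{re}^\times$ and $R^{in}=\mathfrak C_M\cap R_{re}^\times$, where $$\mathfrak B_M=\{\alpha\in\mathrm{span}_{\mathbb Z}R: \{k\in\mathbb Z_{>0}:\lambda+k\alpha\in\mathrm{supp}(M)\}\text{ is finite for all }\lambda\in\mathrm{supp}(M)\},$$ $$\mathfrak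 C_M=\{\alpha\in\mathrm{span}_{\mathbb Z}R:\alpha+\mathrm{supp}(M)\subseteq\mathrm{supp}(M)\}.$$ **Proposition.** Let $\dot\alpha,\dot\beta\in\mathrm{span}_{\mathbb R}\dot R_{re}$ be nonzero with $(\dot\alpha,\dot\beta)=0$. Suppose there are $\lambda\in\mathrm{supp}(M)$, positive integers $n_1<n_2<\cdots$ and $t_1,t_2,\ldots\in\mathbb Z$ such that $\lambda+4n_i(\dot\alpha+\dot\beta)+t_i\delta\in\mathrm{supp}(M)$ for all $i\ge 1$. (i) If $r\in\mathbb Z_{>0}$ and $k\in\{1,2\}$ satisfy $k(-\dot\alpha+r\mathbb Z\delta)\cup(2\dot\beta+r\delta+2r\mathbb Z\delta)\subseteq R_{re}$, then - (a) $k(-\dot\alpha+r\mathbb Z\delta)\cap R^{ln}\neq\emptyset$ or $2\dot\beta+r\delta+2r\mathbb Z\delta\subseteq R^{in}$; and - (b) $(-2\dot\beta-r\delta+2r\mathbb Z\delta)\cap R^{ln}\neq\emptyset$ or $k(\dot\alpha+r\mathbb Z\delta)\subseteq R^{in}$. (ii) If $r\in\mathbb Z_{>0}$ and $k\in\{1,2\}$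 satisfy $k\dot\alpha+2\dot\beta\notin\dot R$ and $k\dot\alpha-2\dot\beta\notin\dot R$, then the dimensions of the weight spaces of $M$ are not bounded, provided that (a) or (b) holds: - (a) $k(\dot\alpha+r\mathbb Z\delta)\subseteq R^{ln}\cap R_0$, $k(-\dot\alpha+r\mathbb Z\delta)\subseteq R^{in}\cap R_0$, and $2\dot\beta+r\delta+2rn^*\delta\in R^{in}$ for some $n^*\in\mathbb Z$; - (b) $2\dot\beta+r\delta+2r\mathbb Z\delta\subseteq R^{ln}\cap R_0$, $-2\dot\beta-r\delta+2r\mathbb Z\delta\subseteq R^{in}\cap R_0$, and $k(\dot\alpha+rn^*\delta)\in R^{in}$ for some $n^*\in\mathbb Z$. -/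

import Mathlib

/-! ## Complex supermatrices -/

/-- Supermatrices with even index set `P` and odd index set `Q`. -/
abbrev SMat (P Q : Type) : Type := Matrix (P ⊕ Q) (P ⊕ Q) ℂ

namespace SMat

/-- The even (block diagonal) part of a supermatrix. -/
def evenPart {P Q : Type} (x : SMat P Q) : SMat P Q :=
  Matrix.fromBlocks x.toBlocks₁₁ 0 0 x.toBlocks₂₂

/-- The odd (block off-diagonal) part of a supermatrix. -/
def oddPart {P Q : Type} (x : SMat P Q) : SMat P Q :=
  Matrix.fromBlocks 0 x.toBlocks₁₂ x.toBlocks₂₁ 0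

/-- The homogeneous supermatrices of parity `i`. -/
def part {P Q : Type} (i : ZMod 2) : Set (SMat P Q) :=
  {x | if i = 0 then x.oddPart = 0 else x.evenPart = 0}

/-- The supertranspose: the blocks `(A, B; C, D)` go to `(Aᵀ, Cᵀ; -Bᵀ, Dᵀ)`. -/
def st {P Q : Type} (x : SMat P Q) : SMat P Q :=
  Matrix.fromBlocks x.toBlocks₁₁.transpose x.toBlocks₂₁.transpose
    (-x.toBlocks₁₂.transpose) x.toBlocks₂₂.transpose

/-- The supertrace `tr A - tr D`. -/
def str {P Q : Type} [Fintype P] [Fintype Q] (x : SMat P Q) : ℂ :=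
  x.toBlocks₁₁.trace - x.toBlocks₂₂.trace

/-- The supercommutator: the bilinear extension of `x y - (-1)^{|x||y|} y x`. -/
def sbr {P Q : Type} [Fintype P] [Fintype Q] (x y : SMat P Q) : SMat P Q :=
  x * y - (y.evenPart * x + y.oddPart * (x.evenPart - x.oddPart))

section lemmas

variable {P Q : Type}

theorem exists_blocks (x : SMat P Q) : ∃ A B C D, x = Matrix.fromBlocks A B C D :=
  ⟨_, _, _, _, (Matrix.fromBlocks_toBlocks x).symm⟩

theorem st_add (x y : SMat P Q) : (x + y).st = x.st + y.st := by
  obtain ⟨A, B, C, D, rfl⟩ := exists_blocks x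
  obtain ⟨A', B', C', D', rfl⟩ := exists_blocks y
  simp [st, Matrix.fromBlocks_add, Matrix.transpose_add, add_comm]

theorem st_smul (c : ℂ) (x : SMat P Q) : (c • x).st = c • x.st := by
  obtain ⟨A, B, C, D, rfl⟩ := exists_blocks x
  simp [st, Matrix.fromBlocks_smul]

variable [Fintype P] [Fintype Q]

theorem str_add (x y : SMat P Q) : (x + y).str = x.str + y.str := by
  obtain ⟨A, B, C, D, rfl⟩ := exists_blocks x
  obtain ⟨A', B', C', D', rfl⟩ := exists_blocks y
  simp [str, Matrix.fromBlocks_add]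
  ring

theorem str_smul (c : ℂ) (x : SMat P Q) : (c • x).str = c * x.str := by
  obtain ⟨A, B, C, D, rfl⟩ := exists_blocks x
  simp [str, Matrix.fromBlocks_smul]
  ring

theorem sbr_fromBlocks (A : Matrix P P ℂ) (B : Matrix P Q ℂ) (C : Matrix Q P ℂ)
    (D : Matrix Q Q ℂ) (A' : Matrix P P ℂ) (B' : Matrix P Q ℂ) (C' : Matrix Q P ℂ)
    (D' : Matrix Q Q ℂ) :
    sbr (Matrix.fromBlocks A B C D) (Matrix.fromBlocks A' B' C' D') =
      Matrix.fromBlocks (A * A' - A' * A + (B * C' + B' * C)) (A * B' + B * D' - A' * B - B' * D)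
        (C * A' + D * C' - D' * C - C' * A) (D * D' - D' * D + (C * B' + C' * B)) := by
  rw [sbr, evenPart, oddPart, evenPart, oddPart]
  simp only [Matrix.toBlocks_fromBlocks₁₁, Matrix.toBlocks_fromBlocks₁₂,
    Matrix.toBlocks_fromBlocks₂₁, Matrix.toBlocks_fromBlocks₂₂, sub_eq_add_neg,
    Matrix.fromBlocks_neg, Matrix.fromBlocks_add, Matrix.fromBlocks_multiply]
  congr 1 <;> simp <;> abel

theorem sbr_add_left (x x' y : SMat P Q) : sbr (x + x') y = sbr x y + sbr x' y := by
  obtain ⟨A, B, C, D, rfl⟩ := exists_blocks x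
  obtain ⟨A', B', C', D', rfl⟩ := exists_blocks x'
  obtain ⟨A'', B'', C'', D'', rfl⟩ := exists_blocks y
  simp only [Matrix.fromBlocks_add, sbr_fromBlocks]
  congr 1 <;> simp only [add_mul, mul_add, Matrix.add_mul, Matrix.mul_add] <;> abel

theorem sbr_add_right (x y y' : SMat P Q) : sbr x (y + y') = sbr x y + sbr x y' := by
  obtain ⟨A, B, C, D, rfl⟩ := exists_blocks x
  obtain ⟨A', B', C', D', rfl⟩ := exists_blocks y
  obtain ⟨A'', B'', C'', D'', rfl⟩ := exists_blocks y'
  simp only [Matrix.fromBlocks_add, sbr_fromBlocks]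
  congr 1 <;> simp only [add_mul, mul_add, Matrix.add_mul, Matrix.mul_add] <;> abel

theorem sbr_smul_left (c : ℂ) (x y : SMat P Q) : sbr (c • x) y = c • sbr x y := by
  obtain ⟨A, B, C, D, rfl⟩ := exists_blocks x
  obtain ⟨A', B', C', D', rfl⟩ := exists_blocks y
  simp only [Matrix.fromBlocks_smul, sbr_fromBlocks]
  congr 1 <;> simp [smul_add, smul_sub]

theorem sbr_smul_right (c : ℂ) (x y : SMat P Q) : sbr x (c • y) = c • sbr x y := by
  obtain ⟨A, B, C, D, rfl⟩ := exists_blocks x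
  obtain ⟨A', B', C', D', rfl⟩ := exists_blocks y
  simp only [Matrix.fromBlocks_smul, sbr_fromBlocks]
  congr 1 <;> simp [smul_add, smul_sub]

theorem str_sbr (x y : SMat P Q) : (sbr x y).str = 0 := by
  obtain ⟨A, B, C, D, rfl⟩ := exists_blocks x
  obtain ⟨A', B', C', D', rfl⟩ := exists_blocks y
  rw [sbr_fromBlocks, str]
  simp only [Matrix.toBlocks_fromBlocks₁₁, Matrix.toBlocks_fromBlocks₂₂, Matrix.trace_add,
    Matrix.trace_sub]
  rw [Matrix.trace_mul_comm A A', Matrix.trace_mul_comm D D', Matrix.trace_mul_comm C B',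
    Matrix.trace_mul_comm C' B]
  ring

variable [DecidableEq P] [DecidableEq Q]

theorem sbr_one_left (y : SMat P Q) : sbr 1 y = 0 := by
  obtain ⟨A, B, C, D, rfl⟩ := exists_blocks y
  rw [← Matrix.fromBlocks_one, sbr_fromBlocks]
  simp

theorem sbr_one_right (y : SMat P Q) : sbr y 1 = 0 := by
  obtain ⟨A, B, C, D, rfl⟩ := exists_blocks y
  rw [← Matrix.fromBlocks_one, sbr_fromBlocks]
  simp

end lemmas

end SMat

/-- A finite-dimensional Lie superalgebra given by supermatrices, together with an automorphism:
a subspace `alg` of supertrace zero matrices, closed under the supercommutator, and a linear map `σ`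
of supermatrices that respects it, the supercommutator and the scalar matrices. -/
structure SuperDatum where
  P : Type
  Q : Type
  [fintypeP : Fintype P]
  [fintypeQ : Fintype Q]
  [decP : DecidableEq P]
  [decQ : DecidableEq Q]
  /-- The subspace of supermatrices. -/
  alg : Submodule ℂ (SMat P Q)
  str_eq_zero : ∀ x ∈ alg, x.str = 0
  sbr_mem : ∀ x ∈ alg, ∀ y ∈ alg, SMat.sbr x y ∈ alg
  /-- The automorphism. -/
  σ : SMat P Q →ₗ[ℂ] SMat P Q
  /-- A positive integer `n` with `σ ^ n = 1`. -/
  n : ℕ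
  σ_mem : ∀ x ∈ alg, σ x ∈ alg
  σ_sbr : ∀ x y, σ (SMat.sbr x y) = SMat.sbr (σ x) (σ y)
  σ_one : σ 1 ∈ Submodule.span ℂ {(1 : SMat P Q)}

attribute [instance] SuperDatum.fintypeP SuperDatum.fintypeQ SuperDatum.decP SuperDatum.decQ

/-! ## The Lie superalgebras of types A and D and their automorphisms -/

/-- An index set with `m` hyperbolic pairs and `a` further basis vectors. -/
abbrev HIdx (m a : ℕ) : Type := (Fin m ⊕ Fin m) ⊕ Fin a

/-- The matrix of the bilinear form which on the hyperbolic pairs is symmetric (`s = 1`) or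
alternating (`s = -1`), and for which the further basis vectors are orthonormal. -/
def hypForm (s : ℂ) (m a : ℕ) : Matrix (HIdx m a) (HIdx m a) ℂ :=
  Matrix.fromBlocks (Matrix.fromBlocks 0 1 (s • 1) 0) 0 0 1

/-- The even bilinear form on `ℂ^(2m+a | 2n+b)`: symmetric on the even part, and the orthogonal sum
of an alternating form on `ℂ^(2n)` and the standard symmetric form on `ℂ^b` on the odd part. For
`b = 0` it is the orthosymplectic form. -/
def superForm (m a n b : ℕ) : SMat (HIdx m a) (HIdx n b) :=
  Matrix.fromBlocks (hypForm 1 m a) 0 0 (hypForm (-1) n b)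

/-- Minus the superadjoint with respect to `B = superForm m a n b`, that is
`x ↦ - B⁻¹ (st x) B`. Here `B⁻¹ = Bᵀ`, since `B` is a real orthogonal matrix. -/
def negAdj (m a n b : ℕ) : SMat (HIdx m a) (HIdx n b) →ₗ[ℂ] SMat (HIdx m a) (HIdx n b) where
  toFun x := -((superForm m a n b).transpose * x.st * superForm m a n b)
  map_add' x y := by
    rw [SMat.st_add, Matrix.mul_add, Matrix.add_mul, neg_add]
  map_smul' c x := by
    rw [SMat.st_smul, Matrix.mul_smul, Matrix.smul_mul, RingHom.id_apply, smul_neg]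

section lemmas

theorem hypForm_mul_transpose (s : ℂ) (hs : s * s = 1) (m a : ℕ) :
    hypForm s m a * (hypForm s m a).transpose = 1 := by
  simp [hypForm, Matrix.fromBlocks_multiply, Matrix.fromBlocks_transpose, hs, smul_smul]

theorem hypForm_transpose_mul (s : ℂ) (hs : s * s = 1) (m a : ℕ) :
    (hypForm s m a).transpose * hypForm s m a = 1 := by
  simp [hypForm, Matrix.fromBlocks_multiply, Matrix.fromBlocks_transpose, hs, smul_smul]

theorem negAdj_fromBlocks (m a n b : ℕ) (A : Matrix (HIdx m a) (HIdx m a) ℂ)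
    (B : Matrix (HIdx m a) (HIdx n b) ℂ) (C : Matrix (HIdx n b) (HIdx m a) ℂ)
    (D : Matrix (HIdx n b) (HIdx n b) ℂ) :
    negAdj m a n b (Matrix.fromBlocks A B C D) =
      Matrix.fromBlocks (-((hypForm 1 m a).transpose * A.transpose * hypForm 1 m a))
        (-((hypForm 1 m a).transpose * C.transpose * hypForm (-1) n b))
        ((hypForm (-1) n b).transpose * B.transpose * hypForm 1 m a)
        (-((hypForm (-1) n b).transpose * D.transpose * hypForm (-1) n b)) := by
  simp [negAdj, superForm, SMat.st, Matrix.fromBlocks_multiply, Matrix.fromBlocks_transpose,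
    Matrix.fromBlocks_neg]

theorem negAdj_one (m a n b : ℕ) : negAdj m a n b 1 = -1 := by
  rw [← Matrix.fromBlocks_one, negAdj_fromBlocks, Matrix.fromBlocks_neg]
  simp [hypForm_transpose_mul]

theorem str_negAdj (m a n b : ℕ) (x : SMat (HIdx m a) (HIdx n b)) :
    (negAdj m a n b x).str = -x.str := by
  obtain ⟨A, B, C, D, rfl⟩ := SMat.exists_blocks x
  rw [negAdj_fromBlocks, SMat.str, SMat.str]
  simp only [Matrix.toBlocks_fromBlocks₁₁, Matrix.toBlocks_fromBlocks₂₂, Matrix.trace_neg]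
  rw [Matrix.trace_mul_comm, ← Matrix.mul_assoc, hypForm_mul_transpose _ (by norm_num),
    Matrix.trace_mul_comm _ (hypForm (-1) n b), ← Matrix.mul_assoc,
    hypForm_mul_transpose _ (by norm_num)]
  simp
  ring

theorem negAdj_sbr (m a n b : ℕ) (x y : SMat (HIdx m a) (HIdx n b)) :
    negAdj m a n b (SMat.sbr x y) = SMat.sbr (negAdj m a n b x) (negAdj m a n b y) := by
  obtain ⟨A, B, C, D, rfl⟩ := SMat.exists_blocks x
  obtain ⟨A', B', C', D', rfl⟩ := SMat.exists_blocks y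
  have hJ := hypForm_mul_transpose 1 (by norm_num) m a
  have hK := hypForm_mul_transpose (-1) (by norm_num) n b
  have hJ' {l : Type} (X : Matrix (HIdx m a) l ℂ) :
      hypForm 1 m a * ((hypForm 1 m a).transpose * X) = X := by
    rw [← Matrix.mul_assoc, hJ, Matrix.one_mul]
  have hK' {l : Type} (X : Matrix (HIdx n b) l ℂ) :
      hypForm (-1) n b * ((hypForm (-1) n b).transpose * X) = X := by
    rw [← Matrix.mul_assoc, hK, Matrix.one_mul]
  simp only [SMat.sbr_fromBlocks, negAdj_fromBlocks]
  congr 1 <;>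
  · simp only [Matrix.transpose_add, Matrix.transpose_sub, Matrix.transpose_mul, Matrix.neg_mul,
      Matrix.mul_neg, neg_neg, Matrix.mul_add, Matrix.add_mul, Matrix.mul_sub, Matrix.sub_mul,
      Matrix.mul_assoc, hJ', hK']
    abel

end lemmas

/-- The special linear Lie superalgebra `sl`. -/
def slSuper (P Q : Type) [Fintype P] [Fintype Q] : Submodule ℂ (SMat P Q) where
  carrier := {x | x.str = 0}
  add_mem' := by
    intro x y hx hy
    rw [Set.mem_ofPred_eq] at *
    rw [SMat.str_add, hx, hy, add_zero]
  zero_mem' := by simpa using SMat.str_smul (0 : ℂ) (0 : SMat P Q)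
  smul_mem' := by
    intro c x hx
    rw [Set.mem_ofPred_eq] at *
    rw [SMat.str_smul, hx, mul_zero]

/-- The orthosymplectic Lie superalgebra `osp(2m | 2n)`: the matrices equal to minus their
superadjoint. -/
def ospSuper (m n : ℕ) : Submodule ℂ (SMat (HIdx m 0) (HIdx n 0)) where
  carrier := {x | negAdj m 0 n 0 x = x}
  add_mem' := by
    intro x y hx hy
    rw [Set.mem_ofPred_eq] at *
    rw [map_add, hx, hy]
  zero_mem' := map_zero _
  smul_mem' := by
    intro c x hx
    rw [Set.mem_ofPred_eq] at *
    rw [map_smul, hx]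

/-- `sl(2m+a | 2n+b)` with the automorphism `negAdj`, of order dividing `o`. -/
def slDatum (m a n b o : ℕ) : SuperDatum where
  P := HIdx m a
  Q := HIdx n b
  alg := slSuper _ _
  str_eq_zero _ hx := hx
  sbr_mem _ _ _ _ := SMat.str_sbr _ _
  σ := negAdj m a n b
  n := o
  σ_mem x hx := by
    change SMat.str _ = 0
    rw [str_negAdj, show x.str = 0 from hx, neg_zero]
  σ_sbr := negAdj_sbr m a n b
  σ_one := by
    rw [negAdj_one]
    exact Submodule.neg_mem _ (Submodule.mem_span_singleton_self _)

/-- The permutation of the basis of `ℂ^(2k+2 | 2l)` that exchanges the two vectors of the last even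
hyperbolic pair; it is an orthogonal reflection of the even part. -/
def lastSwap (k l : ℕ) : Equiv.Perm (HIdx (k + 1) 0 ⊕ HIdx l 0) :=
  Equiv.sumCongr
    (Equiv.swap (Sum.inl (Sum.inl (Fin.last k))) (Sum.inl (Sum.inr (Fin.last k))))
    (Equiv.refl _)

/-- Conjugation of supermatrices by the reflection `lastSwap`. -/
def conjSwap (k l : ℕ) :
    SMat (HIdx (k + 1) 0) (HIdx l 0) →ₗ[ℂ] SMat (HIdx (k + 1) 0) (HIdx l 0) where
  toFun x := x.submatrix (lastSwap k l) (lastSwap k l)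
  map_add' _ _ := rfl
  map_smul' _ _ := rfl

section lemmas

theorem conjSwap_fromBlocks (k l : ℕ) (A : Matrix (HIdx (k + 1) 0) (HIdx (k + 1) 0) ℂ)
    (B : Matrix (HIdx (k + 1) 0) (HIdx l 0) ℂ) (C : Matrix (HIdx l 0) (HIdx (k + 1) 0) ℂ)
    (D : Matrix (HIdx l 0) (HIdx l 0) ℂ) (π : Equiv.Perm (HIdx (k + 1) 0))
    (hπ : π = Equiv.swap (Sum.inl (Sum.inl (Fin.last k))) (Sum.inl (Sum.inr (Fin.last k)))) :
    conjSwap k l (Matrix.fromBlocks A B C D) =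
      Matrix.fromBlocks (A.submatrix π π) (B.submatrix π id) (C.submatrix id π) D := by
  subst hπ
  ext (i | i) (j | j) <;> rfl

theorem conjSwap_sbr (k l : ℕ) (x y : SMat (HIdx (k + 1) 0) (HIdx l 0)) :
    conjSwap k l (SMat.sbr x y) = SMat.sbr (conjSwap k l x) (conjSwap k l y) := by
  obtain ⟨A, B, C, D, rfl⟩ := SMat.exists_blocks x
  obtain ⟨A', B', C', D', rfl⟩ := SMat.exists_blocks y
  obtain ⟨π, hπ⟩ : ∃ π : Equiv.Perm (HIdx (k + 1) 0), π =
    Equiv.swap (Sum.inl (Sum.inl (Fin.last k))) (Sum.inl (Sum.inr (Fin.last k))) := ⟨_, rfl⟩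
  have h₂ (X : Matrix (HIdx l 0) (HIdx (k + 1) 0) ℂ) (Y : Matrix (HIdx (k + 1) 0) (HIdx l 0) ℂ) :
      X.submatrix id π * Y.submatrix π id = X * Y := by
    rw [Matrix.submatrix_mul_equiv, Matrix.submatrix_id_id]
  simp only [SMat.sbr_fromBlocks, conjSwap_fromBlocks k l _ _ _ _ π hπ]
  congr 1
  · ext i j
    simp [Matrix.mul_apply, ← Equiv.sum_comp π (fun p => A (π i) p * A' p (π j)),
      ← Equiv.sum_comp π (fun p => A' (π i) p * A p (π j))]
  · ext i j
    simp [Matrix.mul_apply, ← Equiv.sum_comp π (fun p => A (π i) p * B' p j),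
      ← Equiv.sum_comp π (fun p => A' (π i) p * B p j)]
  · ext i j
    simp [Matrix.mul_apply, ← Equiv.sum_comp π (fun p => C i p * A' p (π j)),
      ← Equiv.sum_comp π (fun p => C' i p * A p (π j))]
  · simp only [h₂]

theorem hypForm_swap (k : ℕ) (π : Equiv.Perm (HIdx (k + 1) 0))
    (hπ : π = Equiv.swap (Sum.inl (Sum.inl (Fin.last k))) (Sum.inl (Sum.inr (Fin.last k)))) :
    (hypForm 1 (k + 1) 0).submatrix π π = hypForm 1 (k + 1) 0 := by
  subst hπ
  ext ((i | i) | i) ((j | j) | j) <;>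
  simp only [hypForm, Matrix.submatrix_apply, Equiv.swap_apply_def] <;>
  split_ifs <;> simp_all [Matrix.one_apply, eq_comm]

theorem negAdj_conjSwap (k l : ℕ) (x : SMat (HIdx (k + 1) 0) (HIdx l 0)) :
    negAdj (k + 1) 0 l 0 (conjSwap k l x) = conjSwap k l (negAdj (k + 1) 0 l 0 x) := by
  obtain ⟨A, B, C, D, rfl⟩ := SMat.exists_blocks x
  obtain ⟨π, hπ⟩ : ∃ π : Equiv.Perm (HIdx (k + 1) 0), π =
    Equiv.swap (Sum.inl (Sum.inl (Fin.last k))) (Sum.inl (Sum.inr (Fin.last k))) := ⟨_, rfl⟩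
  have hJ := hypForm_swap k π hπ
  simp only [negAdj_fromBlocks, conjSwap_fromBlocks k l _ _ _ _ π hπ]
  generalize hypForm 1 (k + 1) 0 = J at *
  generalize hypForm (-1) l 0 = K at *
  congr 1
  · conv_lhs => rw [← hJ]
    simp only [Matrix.transpose_submatrix, Matrix.submatrix_mul_equiv, Matrix.submatrix_neg,
      Pi.neg_apply]
  · conv_lhs => rw [← hJ]
    rw [Matrix.transpose_submatrix, Matrix.transpose_submatrix, Matrix.submatrix_mul_equiv]
    rfl
  · conv_lhs => rw [← hJ]
    rw [Matrix.transpose_submatrix]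
    ext i j
    simp only [Matrix.mul_apply, Matrix.submatrix_apply, Matrix.transpose_apply, id]
    exact Equiv.sum_comp π (fun p => (∑ q, K q i * B p q) * J p (π j))

end lemmas

/-- `osp(2k+2 | 2l)` with conjugation by the reflection `lastSwap`, of order two. -/
def ospDatum (k l : ℕ) : SuperDatum where
  P := HIdx (k + 1) 0
  Q := HIdx l 0
  alg := ospSuper (k + 1) l
  str_eq_zero x hx := by
    have h := str_negAdj (k + 1) 0 l 0 x
    rw [show negAdj (k + 1) 0 l 0 x = x from hx] at h
    linear_combination h / 2
  sbr_mem x hx y hy := by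
    change negAdj _ _ _ _ _ = _
    rw [negAdj_sbr, show negAdj (k + 1) 0 l 0 x = x from hx,
      show negAdj (k + 1) 0 l 0 y = y from hy]
  σ := conjSwap k l
  n := 2
  σ_mem x hx := by
    change negAdj _ _ _ _ _ = _
    rw [negAdj_conjSwap, show negAdj (k + 1) 0 l 0 x = x from hx]
  σ_sbr := conjSwap_sbr k l
  σ_one := by
    have h : conjSwap k l 1 = 1 := Matrix.submatrix_one_equiv _
    rw [h]
    exact Submodule.mem_span_singleton_self _

/-- The types of twisted affine Lie superalgebras with nonzero odd part. -/
inductive TwistedType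
  /-- `A(2k, 2l-1)^(2)` with `k ≥ 0` and `l ≥ 1`. -/
  | evenOdd (k l : ℕ) (hl : 1 ≤ l)
  /-- `A(2k-1, 2l-1)^(2)` with `k, l ≥ 1` and `(k, l) ≠ (1, 1)`. -/
  | oddOdd (k l : ℕ) (hk : 1 ≤ k) (hl : 1 ≤ l) (hkl : (k, l) ≠ (1, 1))
  /-- `A(2k, 2l)^(4)` with `k ≥ 0` and `l ≥ 1`. -/
  | evenEven (k l : ℕ) (hl : 1 ≤ l)
  /-- `D(k+1, l)^(2)` with `k ≥ 0` and `l ≥ 1`. -/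
  | typeD (k l : ℕ) (hl : 1 ≤ l)

/-- The matrix Lie superalgebra and its automorphism that define each twisted affine type:
`sl(2k+1 | 2l)`, `sl(2k | 2l)`, `sl(2k+1 | 2l+1)` and `osp(2k+2 | 2l)`. -/
def TwistedType.datum : TwistedType → SuperDatum
  | evenOdd k l _ => slDatum k 1 l 0 2
  | oddOdd k l _ _ _ => slDatum k 0 l 0 2
  | evenEven k l _ => slDatum k 1 l 1 4
  | typeD k l _ => ospDatum k l


namespace SuperDatum

/-! ## The quotient by the scalar matrices -/

/-- The scalar matrices in `alg`. -/
def scalars (X : SuperDatum) : Submodule ℂ X.alg :=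
  (Submodule.span ℂ {(1 : SMat X.P X.Q)}).comap X.alg.subtype

/-- The Lie superalgebra `𝔤`: the quotient of `alg` by the scalar matrices that it contains. -/
abbrev G (X : SuperDatum) : Type := X.alg ⧸ X.scalars

/-- The supercommutator of `alg`, with values in `𝔤`. -/
def algBr (X : SuperDatum) : X.alg →ₗ[ℂ] X.alg →ₗ[ℂ] X.G :=
  LinearMap.mk₂ ℂ
    (fun x y => X.scalars.mkQ ⟨SMat.sbr x.1 y.1, X.sbr_mem _ x.2 _ y.2⟩)
    (fun x x' y => by
      rw [← map_add]
      exact congrArg _ (Subtype.ext (SMat.sbr_add_left _ _ _)))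
    (fun c x y => by
      rw [← map_smul]
      exact congrArg _ (Subtype.ext (SMat.sbr_smul_left _ _ _)))
    (fun x y y' => by
      rw [← map_add]
      exact congrArg _ (Subtype.ext (SMat.sbr_add_right _ _ _)))
    (fun c x y => by
      rw [← map_smul]
      exact congrArg _ (Subtype.ext (SMat.sbr_smul_right _ _ _)))

theorem mem_scalars_iff (X : SuperDatum) (z : X.alg) :
    z ∈ X.scalars ↔ ∃ c : ℂ, c • (1 : SMat X.P X.Q) = z.1 :=
  Submodule.mem_span_singleton

theorem algBr_scalar_left (X : SuperDatum) (z y : X.alg) (hz : z ∈ X.scalars) :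
    X.algBr z y = 0 := by
  obtain ⟨c, hc⟩ := (X.mem_scalars_iff z).1 hz
  have h : SMat.sbr z.1 y.1 = 0 := by rw [← hc, SMat.sbr_smul_left, SMat.sbr_one_left, smul_zero]
  have h' : (⟨SMat.sbr z.1 y.1, X.sbr_mem _ z.2 _ y.2⟩ : X.alg) = 0 := Subtype.ext h
  change X.scalars.mkQ _ = 0
  rw [h', map_zero]

theorem algBr_scalar_right (X : SuperDatum) (y z : X.alg) (hz : z ∈ X.scalars) :
    X.algBr y z = 0 := by
  obtain ⟨c, hc⟩ := (X.mem_scalars_iff z).1 hz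
  have h : SMat.sbr y.1 z.1 = 0 := by rw [← hc, SMat.sbr_smul_right, SMat.sbr_one_right, smul_zero]
  have h' : (⟨SMat.sbr y.1 z.1, X.sbr_mem _ y.2 _ z.2⟩ : X.alg) = 0 := Subtype.ext h
  change X.scalars.mkQ _ = 0
  rw [h', map_zero]

/-- The bracket of `𝔤`, induced by the supercommutator. -/
def gBr (X : SuperDatum) : X.G →ₗ[ℂ] X.G →ₗ[ℂ] X.G :=
  X.scalars.liftQ
    (LinearMap.flip (X.scalars.liftQ X.algBr.flip fun z hz => by
      ext y
      exact X.algBr_scalar_right y z hz))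
    fun z hz => by
      ext y
      exact X.algBr_scalar_left z y hz

/-- The bilinear form `str (x y)` on `alg`. -/
def algForm (X : SuperDatum) : X.alg →ₗ[ℂ] X.alg →ₗ[ℂ] ℂ :=
  LinearMap.mk₂ ℂ (fun x y => SMat.str (x.1 * y.1))
    (fun x x' y => by
      rw [← SMat.str_add, ← Matrix.add_mul]
      rfl)
    (fun c x y => by
      rw [smul_eq_mul, ← SMat.str_smul, ← Matrix.smul_mul]
      rfl)
    (fun x y y' => by
      rw [← SMat.str_add, ← Matrix.mul_add]
      rfl)
    (fun c x y => by
      rw [smul_eq_mul, ← SMat.str_smul, ← Matrix.mul_smul]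
      rfl)

/-- The supertrace form of `𝔤`, induced by `str (x y)`. -/
def gForm (X : SuperDatum) : X.G →ₗ[ℂ] X.G →ₗ[ℂ] ℂ :=
  X.scalars.liftQ
    (LinearMap.flip (X.scalars.liftQ X.algForm.flip fun z hz => by
      obtain ⟨c, hc⟩ := (X.mem_scalars_iff z).1 hz
      ext y
      change SMat.str (y.1 * z.1) = 0
      rw [← hc, Matrix.mul_smul, Matrix.mul_one, SMat.str_smul, X.str_eq_zero _ y.2, mul_zero]))
    fun z hz => by
      obtain ⟨c, hc⟩ := (X.mem_scalars_iff z).1 hz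
      ext y
      change SMat.str (z.1 * y.1) = 0
      rw [← hc, Matrix.smul_mul, Matrix.one_mul, SMat.str_smul, X.str_eq_zero _ y.2, mul_zero]

/-- The automorphism of `𝔤` induced by `σ`. -/
def gσ (X : SuperDatum) : X.G →ₗ[ℂ] X.G :=
  X.scalars.mapQ X.scalars (X.σ.restrict X.σ_mem) fun z hz => by
    obtain ⟨c, hc⟩ := (X.mem_scalars_iff z).1 hz
    change X.σ z.1 ∈ Submodule.span ℂ {(1 : SMat X.P X.Q)}
    rw [← hc, map_smul]
    exact Submodule.smul_mem _ c X.σ_one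

theorem gσ_gBr (X : SuperDatum) (x y : X.G) : X.gσ (X.gBr x y) = X.gBr (X.gσ x) (X.gσ y) := by
  obtain ⟨x, rfl⟩ := X.scalars.mkQ_surjective x
  obtain ⟨y, rfl⟩ := X.scalars.mkQ_surjective y
  exact congrArg X.scalars.mkQ (Subtype.ext (X.σ_sbr x.1 y.1))

/-- The part of parity `i` of `𝔤`. -/
def gPart (X : SuperDatum) (i : ZMod 2) : Set X.G :=
  X.scalars.mkQ '' {x | x.1 ∈ SMat.part i}

/-- The Cartan subalgebra `𝔥` of `𝔤`: the classes of the diagonal matrices. -/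
def gCartan (X : SuperDatum) : Submodule ℂ X.G :=
  Submodule.map X.scalars.mkQ
    { carrier := {x | x.1.IsDiag}
      add_mem' := fun hx hy => Matrix.IsDiag.add hx hy
      zero_mem' := Matrix.isDiag_zero
      smul_mem' := fun c _ hx => Matrix.IsDiag.smul c hx }

/-! ## The twisted affine Lie superalgebra -/

/-- The primitive `n`-th root of unity `exp (2πi/n)`. -/
noncomputable def ζ (X : SuperDatum) : ℂ := Complex.exp (2 * Real.pi * Complex.I / X.n)

theorem ζ_ne_zero (X : SuperDatum) : X.ζ ≠ 0 := Complex.exp_ne_zero _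

/-- The twisted loop space `⨁ⱼ 𝔤_[j] ⊗ tʲ ℂ[t^(±n)]`, as the space of finitely supported families
`(f p)` in `𝔤` with `σ (f p) = ζ ^ p (f p)`; the family `f` stands for `∑ₚ f p ⊗ tᵖ`. -/
def loop (X : SuperDatum) : Submodule ℂ (ℤ →₀ X.G) where
  carrier := {f | ∀ p, X.gσ (f p) = X.ζ ^ p • f p}
  add_mem' := by
    intro f g hf hg p
    rw [Finsupp.add_apply, map_add, hf p, hg p, smul_add]
  zero_mem' := by simp
  smul_mem' := by
    intro c f hf p
    rw [Finsupp.smul_apply, map_smul, hf p, smul_comm]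

theorem single_mem_loop (X : SuperDatum) (p : ℤ) (x : X.G) (hx : X.gσ x = X.ζ ^ p • x) :
    Finsupp.single p x ∈ X.loop := by
  intro q
  by_cases h : p = q
  · subst h
    simpa using hx
  · simp [Finsupp.single_eq_of_ne' h]

/-- The bracket of loops: `[x ⊗ tᵖ, y ⊗ t^q] = [x, y] ⊗ t^(p+q)`. -/
noncomputable def loopBr (X : SuperDatum) (f g : X.loop) : X.loop :=
  ⟨f.1.sum fun p x => g.1.sum fun q y => Finsupp.single (p + q) (X.gBr x y), by
    refine Submodule.sum_mem _ fun p _ => Submodule.sum_mem _ fun q _ => ?_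
    refine X.single_mem_loop _ _ ?_
    rw [gσ_gBr, f.2 p, g.2 q, zpow_add₀ X.ζ_ne_zero, map_smul, map_smul, LinearMap.smul_apply,
      smul_smul, mul_comm]⟩

/-- The derivation of loops: `x ⊗ tᵖ ↦ p x ⊗ tᵖ`. -/
noncomputable def loopDer (X : SuperDatum) (f : X.loop) : X.loop :=
  ⟨f.1.sum fun p x => Finsupp.single p ((p : ℂ) • x), by
    refine Submodule.sum_mem _ fun p _ => X.single_mem_loop _ _ ?_
    rw [map_smul, f.2 p, smul_comm]⟩

/-- The cocycle `(x ⊗ tᵖ, y ⊗ t^q) ↦ p (x, y) δ_{p+q,0}`. -/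
noncomputable def loopCocycle (X : SuperDatum) (f g : X.loop) : ℂ :=
  f.1.sum fun p x => (p : ℂ) * X.gForm x (g.1 (-p))

/-- The form `(x ⊗ tᵖ, y ⊗ t^q) ↦ (x, y) δ_{p+q,0}`. -/
noncomputable def loopForm (X : SuperDatum) (f g : X.loop) : ℂ :=
  f.1.sum fun p x => X.gForm x (g.1 (-p))

/-- The twisted affine Lie superalgebra `𝔏 = ⨁ⱼ 𝔤_[j] ⊗ tʲ ℂ[t^(±n)] ⊕ ℂ c ⊕ ℂ d`: the triple
`(f, r, s)` stands for `f + r c + s d`. -/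
abbrev Aff (X : SuperDatum) : Type := X.loop × ℂ × ℂ

/-- The bracket of `𝔏`. -/
noncomputable def affBr (X : SuperDatum) (x y : X.Aff) : X.Aff :=
  (X.loopBr x.1 y.1 + x.2.2 • X.loopDer y.1 - y.2.2 • X.loopDer x.1, X.loopCocycle x.1 y.1, 0)

/-- The invariant bilinear form of `𝔏`. -/
noncomputable def affForm (X : SuperDatum) (x y : X.Aff) : ℂ :=
  X.loopForm x.1 y.1 + x.2.1 * y.2.2 + x.2.2 * y.2.1

/-- The part of parity `i` of `𝔏`; the elements `c` and `d` are even. -/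
def affPart (X : SuperDatum) (i : ZMod 2) : Set X.Aff :=
  {x | (∀ p, x.1.1 p ∈ X.gPart i) ∧ (i ≠ 0 → x.2 = 0)}

/-- The Cartan subalgebra `(𝔤_[0] ∩ 𝔥) ⊗ 1 ⊕ ℂ c ⊕ ℂ d` of `𝔏`. (The coefficient of `t⁰` of an
element of `𝔏` automatically lies in `𝔤_[0]`.) -/
def affCartan (X : SuperDatum) : Submodule ℂ X.Aff where
  carrier := {x | (∀ p, p ≠ 0 → x.1.1 p = 0) ∧ x.1.1 0 ∈ X.gCartan}
  add_mem' := by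
    intro x y hx hy
    refine ⟨fun p hp => ?_, X.gCartan.add_mem hx.2 hy.2⟩
    change x.1.1 p + y.1.1 p = 0
    rw [hx.1 p hp, hy.1 p hp, add_zero]
  zero_mem' := ⟨fun _ _ => rfl, X.gCartan.zero_mem⟩
  smul_mem' := by
    intro c x hx
    refine ⟨fun p hp => ?_, X.gCartan.smul_mem c hx.2⟩
    change c • x.1.1 p = 0
    rw [hx.1 p hp, smul_zero]

/-- The dual space of the Cartan subalgebra of `𝔏`. -/
abbrev CartanDual (X : SuperDatum) : Type := Module.Dual ℂ X.affCartan

/-- The element `d` of the Cartan subalgebra. -/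
noncomputable def dElt (X : SuperDatum) : X.affCartan := ⟨(0, 0, 1), fun _ _ => rfl, X.gCartan.zero_mem⟩

/-- The functional `δ` with `δ d = 1` that vanishes on `(𝔤_[0] ∩ 𝔥) ⊗ 1 ⊕ ℂ c`. -/
noncomputable def δ (X : SuperDatum) : X.CartanDual :=
  LinearMap.snd ℂ ℂ ℂ ∘ₗ LinearMap.snd ℂ X.loop (ℂ × ℂ) ∘ₗ X.affCartan.subtype

/-- The vector `t_α` of the Cartan subalgebra with `(t_α, h) = α h` for all `h`; it exists and is
unique because the form is nondegenerate on the Cartan subalgebra. -/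
noncomputable def tVec (X : SuperDatum) (α : X.CartanDual) : X.affCartan :=
  Classical.epsilon fun t => ∀ h : X.affCartan, X.affForm t h = α h

/-- The form on the dual of the Cartan subalgebra, transferred from the Cartan subalgebra. -/
noncomputable def dualForm (X : SuperDatum) (α β : X.CartanDual) : ℂ :=
  X.affForm (X.tVec α) (X.tVec β)

/-! ## Roots -/

/-- The root space `𝔏^α`. -/
def rootSpace (X : SuperDatum) (α : X.CartanDual) : Set X.Aff :=
  {x | ∀ h : X.affCartan, X.affBr h x = α h • x}

/-- The root system `R` of `𝔏`; it contains `0`. -/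
def roots (X : SuperDatum) : Set X.CartanDual :=
  {α | ∃ x ∈ X.rootSpace α, x ≠ 0}

/-- The root system `R₀` of the even part of `𝔏`. -/
def evenRoots (X : SuperDatum) : Set X.CartanDual :=
  {α | ∃ x ∈ X.rootSpace α, x ∈ X.affPart 0 ∧ x ≠ 0}

/-- The nonzero real roots `R_re^×`. -/
def realRootsNZ (X : SuperDatum) : Set X.CartanDual := {α ∈ X.roots | X.dualForm α α ≠ 0}

/-- The real roots `R_re`, zero included. -/
def realRoots (X : SuperDatum) : Set X.CartanDual := {0} ∪ X.realRootsNZ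

/-- The projection `Ṙ` of the root system along `ℤ δ` to the functionals that vanish at `d`. -/
def dotRoots (X : SuperDatum) : Set X.CartanDual :=
  {α | α X.dElt = 0 ∧ ∃ m : ℤ, α + m • X.δ ∈ X.roots}

/-- The real elements `Ṙ_re` of `Ṙ`, zero included. -/
def dotRealRoots (X : SuperDatum) : Set X.CartanDual :=
  {0} ∪ {α ∈ X.dotRoots | ∀ m : ℤ, α + m • X.δ ∈ X.roots → α + m • X.δ ∈ X.realRoots}

/-- The set `α + s δ + q ℤ δ`. -/
def deltaString (X : SuperDatum) (α : X.CartanDual) (s q : ℤ) : Set X.CartanDual :=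
  Set.range fun m : ℤ => α + (s + q * m) • X.δ

/-! ## Weight modules -/

section Modules

variable {M : Type*} [AddCommGroup M] [Module ℂ M]

/-- The linear map `ρ` makes `M` a module over the Lie superalgebra `𝔏`. (A parity grading of `M`
compatible with the action may exist but is not required.) -/
def IsRep (X : SuperDatum) (ρ : X.Aff →ₗ[ℂ] Module.End ℂ M) : Prop :=
  ∀ i j : ZMod 2, ∀ x ∈ X.affPart i, ∀ y ∈ X.affPart j,
    ρ (X.affBr x y) = ρ x * ρ y - (-1 : ℂ) ^ (i.val * j.val) • (ρ y * ρ x)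

/-- The weight space `M^μ`. -/
def weightSpace (X : SuperDatum) (ρ : X.Aff →ₗ[ℂ] Module.End ℂ M) (μ : X.CartanDual) :
    Submodule ℂ M where
  carrier := {v | ∀ h : X.affCartan, ρ h v = μ h • v}
  add_mem' := by
    intro v w hv hw h
    rw [map_add, hv h, hw h, smul_add]
  zero_mem' := by simp
  smul_mem' := by
    intro c v hv h
    rw [map_smul, hv h, smul_comm]

/-- The support of `M`. -/
def supp (X : SuperDatum) (ρ : X.Aff →ₗ[ℂ] Module.End ℂ M) : Set X.CartanDual :=
  {μ | X.weightSpace ρ μ ≠ ⊥}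

/-- `M` is the direct sum of its weight spaces, and these are finite-dimensional. -/
def IsFiniteWeight (X : SuperDatum) (ρ : X.Aff →ₗ[ℂ] Module.End ℂ M) : Prop :=
  iSupIndep (X.weightSpace ρ) ∧ ⨆ μ, X.weightSpace ρ μ = ⊤ ∧
    ∀ μ, FiniteDimensional ℂ (X.weightSpace ρ μ)

/-- `R^in`: the nonzero real roots whose nonzero root vectors act injectively. -/
def injRoots (X : SuperDatum) (ρ : X.Aff →ₗ[ℂ] Module.End ℂ M) : Set X.CartanDual :=
  {α ∈ X.realRootsNZ | ∀ x ∈ X.rootSpace α, x ≠ 0 → Function.Injective (ρ x)}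

/-- `R^ln`: the nonzero real roots whose nonzero root vectors act locally nilpotently. -/
def nilRoots (X : SuperDatum) (ρ : X.Aff →ₗ[ℂ] Module.End ℂ M) : Set X.CartanDual :=
  {α ∈ X.realRootsNZ | ∀ x ∈ X.rootSpace α, x ≠ 0 → ∀ v : M, ∃ N : ℕ, (ρ x ^ N) v = 0}

/-- `𝔅_M`: the `α` in the root lattice such that `μ + k α` is a weight for only finitely many
`k > 0`, for every weight `μ`. -/
def setB (X : SuperDatum) (ρ : X.Aff →ₗ[ℂ] Module.End ℂ M) : Set X.CartanDual :=
  {α | α ∈ AddSubgroup.closure X.roots ∧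
    ∀ μ ∈ X.supp ρ, {k : ℕ | 0 < k ∧ μ + k • α ∈ X.supp ρ}.Finite}

/-- `ℭ_M`: the `α` in the root lattice with `α + supp M ⊆ supp M`. -/
def setC (X : SuperDatum) (ρ : X.Aff →ₗ[ℂ] Module.End ℂ M) : Set X.CartanDual :=
  {α | α ∈ AddSubgroup.closure X.roots ∧ ∀ μ ∈ X.supp ρ, α + μ ∈ X.supp ρ}

/-- `M` has shadow. -/
def HasShadow (X : SuperDatum) (ρ : X.Aff →ₗ[ℂ] Module.End ℂ M) : Prop :=
  X.realRootsNZ = X.injRoots ρ ∪ X.nilRoots ρ ∧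
    X.nilRoots ρ = X.setB ρ ∩ X.realRootsNZ ∧ X.injRoots ρ = X.setC ρ ∩ X.realRootsNZ

/-- The weight multiplicities of `M` are not bounded. -/
def HasUnboundedMultiplicities (X : SuperDatum) (ρ : X.Aff →ₗ[ℂ] Module.End ℂ M) : Prop :=
  ∀ N : ℕ, ∃ μ, N < Module.finrank ℂ (X.weightSpace ρ μ)

end Modules

end SuperDatum

/-! Put `A = kα` and `B = 2β + sδ`, or exchange the two roles. Since `k` divides 4, each given
weight has the form `μ + N A + K B + s' δ`, with `N` and `K` positive multiples of `n i`. The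
integers `s'` are uncontrolled, and removing them is the first step. If `supp M` is stable under the
whole string `-A + qℤδ`, choose by pigeonhole a residue `c` of `s'` modulo `q` that occurs
infinitely often; for those indices one translation by a member of the string replaces `s' δ` by `-A
+ cδ`. So infinitely many `μ' + N A + K B` are weights, with one fixed `μ'`
(`exists_frequently_mem_supp`).

For (i), suppose that no root of the string of `-A` is locally nilpotent. By the shadow the support
is stable under it. Subtracting `A` a further `N` times gives weights `μ' + K B` with `K` unbounded,
so `B` is not in `setB`, hence not locally nilpotent, hence injective (`notMem_setB_of_frequently`).

For (ii), let `e, f, h` be an sl₂-triple for the even real root `A`, with `e` locally nilpotent, and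
let `g` be a root vector of `B`, which acts injectively. As `A + B` is not a root, `g` commutes with
`e`; as `A ⊥ B`, it does not change `h`-eigenvalues. In the weight space of `μ' + K B` consider the
kernel of a power `e ^ D`. Powers of `g` embed it into the corresponding kernel for every later `K`.
A weight vector at `μ' + N A + K B` with `N ≥ D` large is raised by `e` to a highest weight vector
and lowered by `f` to weight `μ' + K B`; sl₂-theory shows that `e ^ N` does not kill the result, so
it lies outside the embedded kernel. Hence the dimension grows at each repetition
(`IsRegular.hasUnboundedMultiplicities`).

The structure theory needed is modest: roots are symmetric, the form on the Cartan subalgebra is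
nondegenerate, root vectors can be chosen homogeneous, and even real roots have sl₂-triples. All of
it follows from the few properties collected in `IsRegular`, which are checked on matrices for the
four types. -/

namespace SMat

/-! ### Parity of supermatrices and invariance of the supertrace form. -/

section

variable {P Q : Type}

theorem part_zero_iff (x : SMat P Q) : x ∈ part 0 ↔ x.oddPart = 0 := by
  simp [part]

theorem part_one_iff (x : SMat P Q) : x ∈ part 1 ↔ x.evenPart = 0 := by
  simp [part]

theorem fromBlocks_mem_part_zero (A : Matrix P P ℂ) (B : Matrix P Q ℂ) (C : Matrix Q P ℂ)
    (D : Matrix Q Q ℂ) : Matrix.fromBlocks A B C D ∈ part 0 ↔ B = 0 ∧ C = 0 := by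
  rw [part_zero_iff, oddPart, ← Matrix.fromBlocks_zero, Matrix.fromBlocks_inj]
  simp

theorem fromBlocks_mem_part_one (A : Matrix P P ℂ) (B : Matrix P Q ℂ) (C : Matrix Q P ℂ)
    (D : Matrix Q Q ℂ) : Matrix.fromBlocks A B C D ∈ part 1 ↔ A = 0 ∧ D = 0 := by
  rw [part_one_iff, evenPart, ← Matrix.fromBlocks_zero, Matrix.fromBlocks_inj]
  simp

theorem add_mem_part {i : ZMod 2} {x y : SMat P Q} (hx : x ∈ part i) (hy : y ∈ part i) :
    x + y ∈ part i := by
  obtain ⟨A, B, C, D, rfl⟩ := exists_blocks x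
  obtain ⟨A', B', C', D', rfl⟩ := exists_blocks y
  rw [Matrix.fromBlocks_add]
  fin_cases i
  · have hx' := (fromBlocks_mem_part_zero _ _ _ _).1 hx
    have hy' := (fromBlocks_mem_part_zero _ _ _ _).1 hy
    exact (fromBlocks_mem_part_zero _ _ _ _).2 (by simp [hx', hy'])
  · have hx' := (fromBlocks_mem_part_one _ _ _ _).1 hx
    have hy' := (fromBlocks_mem_part_one _ _ _ _).1 hy
    exact (fromBlocks_mem_part_one _ _ _ _).2 (by simp [hx', hy'])

theorem smul_mem_part {i : ZMod 2} (c : ℂ) {x : SMat P Q} (hx : x ∈ part i) :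
    c • x ∈ part i := by
  obtain ⟨A, B, C, D, rfl⟩ := exists_blocks x
  rw [Matrix.fromBlocks_smul]
  fin_cases i
  · have hx' := (fromBlocks_mem_part_zero _ _ _ _).1 hx
    exact (fromBlocks_mem_part_zero _ _ _ _).2 (by simp [hx'])
  · have hx' := (fromBlocks_mem_part_one _ _ _ _).1 hx
    exact (fromBlocks_mem_part_one _ _ _ _).2 (by simp [hx'])

theorem zero_mem_part (i : ZMod 2) : (0 : SMat P Q) ∈ part i := by
  rw [← Matrix.fromBlocks_zero]
  fin_cases i
  · exact (fromBlocks_mem_part_zero _ _ _ _).2 ⟨rfl, rfl⟩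
  · exact (fromBlocks_mem_part_one _ _ _ _).2 ⟨rfl, rfl⟩

theorem isDiag_mem_part_zero {x : SMat P Q} (hx : x.IsDiag) : x ∈ part 0 := by
  obtain ⟨A, B, C, D, rfl⟩ := exists_blocks x
  refine (fromBlocks_mem_part_zero _ _ _ _).2 ⟨?_, ?_⟩
  · ext i j
    exact hx (i := Sum.inl i) (j := Sum.inr j) (by simp)
  · ext i j
    exact hx (i := Sum.inr i) (j := Sum.inl j) (by simp)

variable [Fintype P] [Fintype Q]

theorem str_fromBlocks_mul (A : Matrix P P ℂ) (B : Matrix P Q ℂ) (C : Matrix Q P ℂ)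
    (D : Matrix Q Q ℂ) (A' : Matrix P P ℂ) (B' : Matrix P Q ℂ) (C' : Matrix Q P ℂ)
    (D' : Matrix Q Q ℂ) :
    str (Matrix.fromBlocks A B C D * Matrix.fromBlocks A' B' C' D') =
      (A * A').trace + (B * C').trace - ((C * B').trace + (D * D').trace) := by
  simp [Matrix.fromBlocks_multiply, str]

/-- Block by block this is cyclicity of the trace; the signs of the supercommutator match those of
the supertrace, so no homogeneity is needed. -/
theorem str_sbr_mul (x y z : SMat P Q) : str (sbr x y * z) = str (x * sbr y z) := by
  obtain ⟨A, B, C, D, rfl⟩ := exists_blocks x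
  obtain ⟨A', B', C', D', rfl⟩ := exists_blocks y
  obtain ⟨E, F, G, H, rfl⟩ := exists_blocks z
  simp only [sbr_fromBlocks, str_fromBlocks_mul]
  simp only [Matrix.add_mul, Matrix.sub_mul, Matrix.mul_add, Matrix.mul_sub, Matrix.trace_add,
    Matrix.trace_sub, ← Matrix.mul_assoc]
  rw [Matrix.trace_mul_cycle A' A E, Matrix.trace_mul_cycle B' C E, Matrix.trace_mul_cycle A' B G,
    Matrix.trace_mul_cycle B' D G, Matrix.trace_mul_cycle D' C F, Matrix.trace_mul_cycle C' A F,
    Matrix.trace_mul_cycle D' D H, Matrix.trace_mul_cycle C' B H]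
  rw [Matrix.trace_mul_cycle E A' A, Matrix.trace_mul_cycle E B' C, Matrix.trace_mul_cycle G A' B,
    Matrix.trace_mul_cycle G B' D, Matrix.trace_mul_cycle F D' C, Matrix.trace_mul_cycle F C' A,
    Matrix.trace_mul_cycle H D' D, Matrix.trace_mul_cycle H C' B]
  ring

theorem str_mul_comm_of_even {x y : SMat P Q} (hx : x ∈ part 0) :
    str (x * y) = str (y * x) := by
  obtain ⟨A, B, C, D, rfl⟩ := exists_blocks x
  obtain ⟨A', B', C', D', rfl⟩ := exists_blocks y
  obtain ⟨rfl, rfl⟩ := (fromBlocks_mem_part_zero _ _ _ _).1 hx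
  simp only [str_fromBlocks_mul]
  rw [Matrix.trace_mul_comm A, Matrix.trace_mul_comm D]
  simp

theorem str_mul_eq_zero {x y : SMat P Q} (hx : x ∈ part 0) (hy : y ∈ part 1) :
    str (x * y) = 0 := by
  obtain ⟨A, B, C, D, rfl⟩ := exists_blocks x
  obtain ⟨A', B', C', D', rfl⟩ := exists_blocks y
  obtain ⟨rfl, rfl⟩ := (fromBlocks_mem_part_zero _ _ _ _).1 hx
  obtain ⟨rfl, rfl⟩ := (fromBlocks_mem_part_one _ _ _ _).1 hy
  simp [str_fromBlocks_mul]

theorem sbr_mem_part_zero {x y : SMat P Q} (hx : x ∈ part 0) (hy : y ∈ part 0) :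
    sbr x y ∈ part 0 := by
  obtain ⟨A, B, C, D, rfl⟩ := exists_blocks x
  obtain ⟨A', B', C', D', rfl⟩ := exists_blocks y
  obtain ⟨rfl, rfl⟩ := (fromBlocks_mem_part_zero _ _ _ _).1 hx
  obtain ⟨rfl, rfl⟩ := (fromBlocks_mem_part_zero _ _ _ _).1 hy
  rw [sbr_fromBlocks, fromBlocks_mem_part_zero]
  simp

theorem sbr_eq_commutator {x : SMat P Q} (hx : x ∈ part 0) (y : SMat P Q) :
    sbr x y = x * y - y * x := by
  obtain ⟨A, B, C, D, rfl⟩ := exists_blocks x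
  obtain ⟨A', B', C', D', rfl⟩ := exists_blocks y
  obtain ⟨rfl, rfl⟩ := (fromBlocks_mem_part_zero _ _ _ _).1 hx
  rw [sbr_fromBlocks, Matrix.fromBlocks_multiply, Matrix.fromBlocks_multiply,
    eq_sub_iff_add_eq, Matrix.fromBlocks_add]
  congr 1 <;> simp

theorem sbr_eq_neg_commutator {x : SMat P Q} (hx : x ∈ part 0) (y : SMat P Q) :
    sbr y x = -sbr x y := by
  obtain ⟨A, B, C, D, rfl⟩ := exists_blocks x
  obtain ⟨A', B', C', D', rfl⟩ := exists_blocks y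
  obtain ⟨rfl, rfl⟩ := (fromBlocks_mem_part_zero _ _ _ _).1 hx
  rw [sbr_fromBlocks, sbr_fromBlocks, Matrix.fromBlocks_neg]
  congr 1 <;> simp

/-- The sign-free case of the super Jacobi identity. It suffices for weight arguments, since Cartan
elements are even. -/
theorem sbr_sbr_of_even {h : SMat P Q} (hh : h ∈ part 0) (x y : SMat P Q) :
    sbr h (sbr x y) = sbr (sbr h x) y + sbr x (sbr h y) := by
  obtain ⟨H, F, G, K, rfl⟩ := exists_blocks h
  obtain ⟨A, B, C, D, rfl⟩ := exists_blocks x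
  obtain ⟨A', B', C', D', rfl⟩ := exists_blocks y
  obtain ⟨rfl, rfl⟩ := (fromBlocks_mem_part_zero _ _ _ _).1 hh
  simp only [sbr_fromBlocks, Matrix.fromBlocks_add]
  congr 1 <;>
  · simp only [Matrix.zero_mul, Matrix.mul_zero, add_zero, zero_add, sub_zero,
      Matrix.add_mul, Matrix.sub_mul, Matrix.mul_add, Matrix.mul_sub, Matrix.mul_assoc]
    abel

end

end SMat

/-! ### The quotient superalgebra `𝔤` and the properties its loop algebra relies on. -/

namespace SuperDatum

variable (X : SuperDatum)

theorem gBr_mkQ (x y : X.alg) : X.gBr (X.scalars.mkQ x) (X.scalars.mkQ y) =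
    X.scalars.mkQ ⟨SMat.sbr x.1 y.1, X.sbr_mem _ x.2 _ y.2⟩ := rfl

theorem mem_gCartan {x : X.G} : x ∈ X.gCartan ↔ ∃ y : X.alg, y.1.IsDiag ∧ X.scalars.mkQ y = x :=
  Iff.rfl

theorem gForm_gBr (x y z : X.G) : X.gForm (X.gBr x y) z = X.gForm x (X.gBr y z) := by
  obtain ⟨x, rfl⟩ := X.scalars.mkQ_surjective x
  obtain ⟨y, rfl⟩ := X.scalars.mkQ_surjective y
  obtain ⟨z, rfl⟩ := X.scalars.mkQ_surjective z
  exact SMat.str_sbr_mul _ _ _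

theorem gPart_zero_of_mem_gCartan {h : X.G} (hh : h ∈ X.gCartan) : h ∈ X.gPart 0 := by
  obtain ⟨x, hx, rfl⟩ := X.mem_gCartan.1 hh
  exact ⟨x, SMat.isDiag_mem_part_zero hx, rfl⟩

theorem gForm_comm {x : X.G} (hx : x ∈ X.gPart 0) (y : X.G) : X.gForm x y = X.gForm y x := by
  obtain ⟨x, hx, rfl⟩ := hx
  obtain ⟨y, rfl⟩ := X.scalars.mkQ_surjective y
  exact SMat.str_mul_comm_of_even hx

theorem gForm_eq_zero {x y : X.G} (hx : x ∈ X.gPart 0) (hy : y ∈ X.gPart 1) : X.gForm x y = 0 := by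
  obtain ⟨x, hx, rfl⟩ := hx
  obtain ⟨y, hy, rfl⟩ := hy
  exact SMat.str_mul_eq_zero hx hy

theorem gBr_mem_gPart_zero {x y : X.G} (hx : x ∈ X.gPart 0) (hy : y ∈ X.gPart 0) :
    X.gBr x y ∈ X.gPart 0 := by
  obtain ⟨x, hx, rfl⟩ := hx
  obtain ⟨y, hy, rfl⟩ := hy
  exact ⟨_, SMat.sbr_mem_part_zero hx hy, rfl⟩

theorem gBr_skew {x : X.G} (hx : x ∈ X.gPart 0) (y : X.G) : X.gBr y x = -X.gBr x y := by
  obtain ⟨x, hx, rfl⟩ := hx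
  obtain ⟨y, rfl⟩ := X.scalars.mkQ_surjective y
  rw [gBr_mkQ, gBr_mkQ, ← map_neg]
  exact congrArg _ (Subtype.ext (SMat.sbr_eq_neg_commutator hx _))

theorem gBr_gBr {h : X.G} (hh : h ∈ X.gPart 0) (x y : X.G) :
    X.gBr h (X.gBr x y) = X.gBr (X.gBr h x) y + X.gBr x (X.gBr h y) := by
  obtain ⟨h, hh, rfl⟩ := hh
  obtain ⟨x, rfl⟩ := X.scalars.mkQ_surjective x
  obtain ⟨y, rfl⟩ := X.scalars.mkQ_surjective y
  simp only [gBr_mkQ]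
  rw [← map_add]
  exact congrArg _ (Subtype.ext (SMat.sbr_sbr_of_even hh _ _))

/-- The homogeneous elements of `𝔤` of a given parity, as a subspace. -/
def gPartSubmodule (i : ZMod 2) : Submodule ℂ X.G where
  carrier := X.gPart i
  add_mem' := by
    rintro _ _ ⟨x, hx, rfl⟩ ⟨y, hy, rfl⟩
    exact ⟨x + y, SMat.add_mem_part hx hy, map_add _ _ _⟩
  zero_mem' := ⟨0, SMat.zero_mem_part i, map_zero _⟩
  smul_mem' := by
    rintro c _ ⟨x, hx, rfl⟩
    exact ⟨c • x, SMat.smul_mem_part c hx, map_smul _ _ _⟩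

/-- The properties of a matrix Lie superalgebra with automorphism on which the structure theory of
the corresponding twisted affine Lie superalgebra rests. -/
structure IsRegular : Prop where
  n_pos : 0 < X.n
  gσ_pow : X.gσ ^ X.n = 1
  gForm_gσ : ∀ x y, X.gForm (X.gσ x) (X.gσ y) = X.gForm x y
  gσ_mem_gPart : ∀ i, ∀ x ∈ X.gPart i, X.gσ x ∈ X.gPart i
  exists_weight_vector : ∀ x : X.G, x ≠ 0 → ∃ i, ∃ y ∈ X.gPart i,
    (∀ h ∈ X.gCartan, ∃ c : ℂ, X.gBr h y = c • y) ∧ X.gForm x y ≠ 0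
  mem_gCartan_of_centralizes : ∀ x ∈ X.gPart 0,
    (∀ h ∈ X.gCartan, X.gσ h = h → X.gBr h x = 0) → x ∈ X.gCartan

end SuperDatum

/-! ### Matrix units, diagonal matrices and torus weights. -/

namespace SMat

variable {P Q : Type}

/-- The sign of a basis vector: `1` for even and `-1` for odd ones. -/
def sgn (i : P ⊕ Q) : ℂ := Sum.elim (fun _ => 1) (fun _ => -1) i

theorem sgn_mul_self (i : P ⊕ Q) : sgn i * sgn i = 1 := by
  rcases i with i | i <;> simp [sgn]

theorem sgn_ne_zero (i : P ⊕ Q) : sgn i ≠ 0 := by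
  rcases i with i | i <;> simp [sgn]

theorem exists_single_mem_part [DecidableEq P] [DecidableEq Q] (i j : P ⊕ Q) :
    ∃ p, (Matrix.single i j 1 : SMat P Q) ∈ part p := by
  rcases i with i | i <;> rcases j with j | j
  · refine ⟨0, (part_zero_iff _).2 ?_⟩
    ext (a | a) (b | b) <;> simp [oddPart, Matrix.toBlocks₁₂, Matrix.toBlocks₂₁, Matrix.single]
  · refine ⟨1, (part_one_iff _).2 ?_⟩
    ext (a | a) (b | b) <;> simp [evenPart, Matrix.toBlocks₁₁, Matrix.toBlocks₂₂, Matrix.single]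
  · refine ⟨1, (part_one_iff _).2 ?_⟩
    ext (a | a) (b | b) <;> simp [evenPart, Matrix.toBlocks₁₁, Matrix.toBlocks₂₂, Matrix.single]
  · refine ⟨0, (part_zero_iff _).2 ?_⟩
    ext (a | a) (b | b) <;> simp [oddPart, Matrix.toBlocks₁₂, Matrix.toBlocks₂₁, Matrix.single]

variable [Fintype P] [Fintype Q]

theorem str_eq_sum (x : SMat P Q) : x.str = ∑ i, sgn i * x i i := by
  simp [str, Matrix.trace, sgn, Fintype.sum_sum_type, Matrix.toBlocks₁₁, Matrix.toBlocks₂₂,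
    sub_eq_add_neg]

variable [DecidableEq P] [DecidableEq Q]

theorem str_mul_single (x : SMat P Q) (i j : P ⊕ Q) :
    str (x * Matrix.single j i 1) = sgn i * x i j := by
  rw [str_eq_sum, Finset.sum_eq_single i]
  · simp
  · intro k _ hk
    rw [Matrix.mul_single_apply_of_ne _ _ _ _ _ (by simpa using hk), mul_zero]
  · simp

theorem str_mul_diagonal (x : SMat P Q) (d : P ⊕ Q → ℂ) :
    str (x * Matrix.diagonal d) = ∑ i, sgn i * (x i i * d i) := by
  simp [str_eq_sum]

theorem sbr_apply_of_isDiag {h : SMat P Q} (hh : h.IsDiag) (x : SMat P Q) (i j : P ⊕ Q) :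
    sbr h x i j = (h i i - h j j) * x i j := by
  rw [sbr_eq_commutator (isDiag_mem_part_zero hh), ← hh.diagonal_diag]
  simp [Matrix.diagonal_mul, Matrix.mul_diagonal]
  ring

theorem sbr_single_of_isDiag {h : SMat P Q} (hh : h.IsDiag) (i j : P ⊕ Q) :
    sbr h (Matrix.single i j 1) = (h i i - h j j) • Matrix.single i j 1 := by
  ext a b
  rw [sbr_apply_of_isDiag hh, Matrix.smul_apply, Matrix.single_apply]
  split_ifs with hab
  · rw [← hab.1, ← hab.2, smul_eq_mul]
  · simp

end SMat

/-- The diagonal of an element of the torus preserving `hypForm`: opposite values on the two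
vectors of every hyperbolic pair, and zero on the further basis vectors. -/
def hypDiag {m : ℕ} (a : ℕ) (w : Fin m → ℂ) : HIdx m a → ℂ := Sum.elim (Sum.elim w (-w)) 0

/-- The torus weights of the basis vectors are `±ε_p` and, at most once because `a ≤ 1`, zero; they
are pairwise distinct. -/
theorem exists_hypDiag_ne {m a : ℕ} (ha : a ≤ 1) {i j : HIdx m a} (hij : i ≠ j) :
    ∃ w : Fin m → ℂ, hypDiag a w i ≠ hypDiag a w j := by
  have key : ∀ p q : Fin m, ∀ s : ℂ, s ≠ 1 → (1 : ℂ) ≠ s * (Pi.single p 1 : Fin m → ℂ) q := by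
    intro p q s hs
    by_cases hpq : q = p
    · subst hpq
      simpa using hs.symm
    · simp [hpq]
  have := Fin.subsingleton_iff_le_one.2 ha
  have h1 : (-1 : ℂ) ≠ 1 := by norm_num
  rcases i with (i | i) | i <;> rcases j with (j | j) | j
  · refine ⟨Pi.single i 1, ?_⟩
    have : j ≠ i := fun h => hij (by rw [h])
    simp [hypDiag, this]
  · exact ⟨Pi.single i 1, by simpa [hypDiag] using key i j (-1) h1⟩
  · exact ⟨Pi.single i 1, by simp [hypDiag]⟩
  · exact ⟨Pi.single j 1, by simpa [hypDiag] using (key j i (-1) h1).symm⟩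
  · refine ⟨Pi.single i 1, ?_⟩
    have : j ≠ i := fun h => hij (by rw [h])
    simp [hypDiag, this]
  · exact ⟨Pi.single i 1, by simp [hypDiag]⟩
  · exact ⟨Pi.single j 1, by simp [hypDiag]⟩
  · exact ⟨Pi.single j 1, by simp [hypDiag]⟩
  · exact absurd (congrArg Sum.inr (Subsingleton.elim i j)) hij

/-! ### Order and isometry of minus the superadjoint. -/

theorem hypForm_mul_self (s : ℂ) (m a : ℕ) : hypForm s m a * hypForm s m a =
    Matrix.fromBlocks (Matrix.fromBlocks (s • 1) 0 0 (s • 1)) 0 0 1 := by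
  simp [hypForm, Matrix.fromBlocks_multiply]

theorem hypForm_one_mul_self (m a : ℕ) : hypForm 1 m a * hypForm 1 m a = 1 := by
  simp [hypForm_mul_self]

theorem hypForm_one_transpose (m a : ℕ) : (hypForm 1 m a).transpose = hypForm 1 m a := by
  simp [hypForm, Matrix.fromBlocks_transpose]

theorem hypForm_neg_one_mul_self (n : ℕ) : hypForm (-1) n 0 * hypForm (-1) n 0 = -1 := by
  rw [hypForm_mul_self, ← Matrix.fromBlocks_one, ← Matrix.fromBlocks_one, Matrix.fromBlocks_neg,
    Matrix.fromBlocks_neg]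
  congr 1
  · simp
  · simp
  · simp
  · ext i
    exact i.elim0

/-- Conjugation by the form exchanges the two vectors of each hyperbolic pair, hence `w` and `-w`.
-/
theorem hypForm_transpose_mul_diagonal_mul (s : ℂ) (hs : s * s = 1) {m : ℕ} (a : ℕ)
    (w : Fin m → ℂ) :
    (hypForm s m a).transpose * Matrix.diagonal (hypDiag a w) * hypForm s m a =
      -Matrix.diagonal (hypDiag a w) := by
  have h : Matrix.diagonal (hypDiag a w) =
      Matrix.fromBlocks (Matrix.fromBlocks (Matrix.diagonal w) 0 0 (-Matrix.diagonal w)) 0 0 0 := by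
    rw [Matrix.diagonal_neg, Matrix.fromBlocks_diagonal, ← Matrix.diagonal_zero,
      Matrix.fromBlocks_diagonal]
    rfl
  rw [h, hypForm]
  generalize Matrix.diagonal w = W
  simp [Matrix.fromBlocks_multiply, Matrix.fromBlocks_transpose, Matrix.fromBlocks_neg, hs,
    smul_smul]

/-- The square is governed by `K²`, where `K` is the form on the odd part. For `b = 0` one has `K² =
-1` and the square is the identity; for `b = 1` and `n > 0` the matrix `K²` has both eigenvalues
`-1` and `1`, and only the fourth power is trivial. -/
theorem negAdj_negAdj (m a n b : ℕ) (A : Matrix (HIdx m a) (HIdx m a) ℂ)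
    (B : Matrix (HIdx m a) (HIdx n b) ℂ) (C : Matrix (HIdx n b) (HIdx m a) ℂ)
    (D : Matrix (HIdx n b) (HIdx n b) ℂ) :
    negAdj m a n b (negAdj m a n b (Matrix.fromBlocks A B C D)) =
      Matrix.fromBlocks A (-(B * (hypForm (-1) n b * hypForm (-1) n b)))
        (-(hypForm (-1) n b * hypForm (-1) n b * C))
        (hypForm (-1) n b * hypForm (-1) n b * D * (hypForm (-1) n b * hypForm (-1) n b)) := by
  have hJ {l : Type} (Y : Matrix (HIdx m a) l ℂ) : hypForm 1 m a * (hypForm 1 m a * Y) = Y := by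
    rw [← Matrix.mul_assoc, hypForm_one_mul_self, Matrix.one_mul]
  have hK : (hypForm (-1) n b).transpose * (hypForm (-1) n b).transpose =
      hypForm (-1) n b * hypForm (-1) n b := by
    rw [← Matrix.transpose_mul, hypForm_mul_self]
    simp [Matrix.fromBlocks_transpose]
  have hK' {l : Type} (Y : Matrix (HIdx n b) l ℂ) :
      (hypForm (-1) n b).transpose * ((hypForm (-1) n b).transpose * Y) =
        hypForm (-1) n b * (hypForm (-1) n b * Y) := by
    rw [← Matrix.mul_assoc, hK, Matrix.mul_assoc]
  rw [negAdj_fromBlocks, negAdj_fromBlocks]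
  congr 1 <;>
  simp [Matrix.transpose_mul, Matrix.mul_assoc, hypForm_one_transpose, hJ, hK',
    hypForm_one_mul_self]

theorem negAdj_negAdj_of_eq_zero (m a n : ℕ) (x : SMat (HIdx m a) (HIdx n 0)) :
    negAdj m a n 0 (negAdj m a n 0 x) = x := by
  obtain ⟨A, B, C, D, rfl⟩ := SMat.exists_blocks x
  rw [negAdj_negAdj, hypForm_neg_one_mul_self]
  simp

theorem negAdj_pow_four (m a n b : ℕ) (x : SMat (HIdx m a) (HIdx n b)) :
    negAdj m a n b (negAdj m a n b (negAdj m a n b (negAdj m a n b x))) = x := by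
  have hK : hypForm (-1) n b * hypForm (-1) n b * (hypForm (-1) n b * hypForm (-1) n b) = 1 := by
    simp [hypForm_mul_self, Matrix.fromBlocks_multiply]
  obtain ⟨A, B, C, D, rfl⟩ := SMat.exists_blocks x
  rw [negAdj_negAdj, negAdj_negAdj]
  generalize hypForm (-1) n b * hypForm (-1) n b = S at hK ⊢
  have hK' {l : Type} (Y : Matrix (HIdx n b) l ℂ) : S * (S * Y) = Y := by
    rw [← Matrix.mul_assoc, hK, Matrix.one_mul]
  simp [Matrix.mul_assoc, hK, hK']

theorem str_negAdj_mul (m a n b : ℕ) (x y : SMat (HIdx m a) (HIdx n b)) :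
    SMat.str (negAdj m a n b x * negAdj m a n b y) = SMat.str (x * y) := by
  obtain ⟨A, B, C, D, rfl⟩ := SMat.exists_blocks x
  obtain ⟨A', B', C', D', rfl⟩ := SMat.exists_blocks y
  have hJ := hypForm_mul_transpose 1 (by norm_num) m a
  have hK := hypForm_mul_transpose (-1) (by norm_num) n b
  rw [negAdj_fromBlocks, negAdj_fromBlocks, SMat.str_fromBlocks_mul, SMat.str_fromBlocks_mul]
  generalize hypForm 1 m a = J at *
  generalize hypForm (-1) n b = K at *
  have key {ι κ : Type} [Fintype ι] [Fintype κ] [DecidableEq ι] [DecidableEq κ] (E : Matrix ι ι ℂ)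
      (F : Matrix κ κ ℂ) (hE : E * E.transpose = 1) (hF : F * F.transpose = 1)
      (U : Matrix κ ι ℂ) (V : Matrix ι κ ℂ) :
      ((E.transpose * U.transpose * F) * (F.transpose * V.transpose * E)).trace = (V * U).trace := by
    rw [Matrix.trace_mul_comm, Matrix.mul_assoc, ← Matrix.mul_assoc E, ← Matrix.mul_assoc E, hE,
      Matrix.one_mul, Matrix.trace_mul_comm, Matrix.mul_assoc, ← Matrix.mul_assoc F,
      hF, Matrix.one_mul, ← Matrix.transpose_mul, Matrix.trace_transpose]
  simp only [Matrix.neg_mul, Matrix.mul_neg, neg_neg, Matrix.trace_neg, key _ _ hJ hJ,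
    key _ _ hJ hK, key _ _ hK hJ, key _ _ hK hK]
  rw [Matrix.trace_mul_comm A', Matrix.trace_mul_comm D', Matrix.trace_mul_comm C',
    Matrix.trace_mul_comm B']
  ring

theorem negAdj_mem_part (m a n b : ℕ) (i : ZMod 2) {x : SMat (HIdx m a) (HIdx n b)}
    (hx : x ∈ SMat.part i) : negAdj m a n b x ∈ SMat.part i := by
  obtain ⟨A, B, C, D, rfl⟩ := SMat.exists_blocks x
  rw [negAdj_fromBlocks]
  fin_cases i
  · obtain ⟨rfl, rfl⟩ := (SMat.fromBlocks_mem_part_zero _ _ _ _).1 hx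
    exact (SMat.fromBlocks_mem_part_zero _ _ _ _).2 (by simp)
  · obtain ⟨rfl, rfl⟩ := (SMat.fromBlocks_mem_part_one _ _ _ _).1 hx
    exact (SMat.fromBlocks_mem_part_one _ _ _ _).2 (by simp)

/-- The diagonal supermatrices fixed by `negAdj`. -/
def hypTorus {m n : ℕ} (a b : ℕ) (u : Fin m → ℂ) (v : Fin n → ℂ) : SMat (HIdx m a) (HIdx n b) :=
  Matrix.diagonal (Sum.elim (hypDiag a u) (hypDiag b v))

theorem hypTorus_isDiag {m n : ℕ} (a b : ℕ) (u : Fin m → ℂ) (v : Fin n → ℂ) :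
    (hypTorus a b u v).IsDiag := Matrix.isDiag_diagonal _

theorem negAdj_hypTorus {m n : ℕ} (a b : ℕ) (u : Fin m → ℂ) (v : Fin n → ℂ) :
    negAdj m a n b (hypTorus a b u v) = hypTorus a b u v := by
  rw [hypTorus, ← Matrix.fromBlocks_diagonal, negAdj_fromBlocks]
  simp only [Matrix.diagonal_transpose]
  rw [hypForm_transpose_mul_diagonal_mul 1 (by norm_num),
    hypForm_transpose_mul_diagonal_mul (-1) (by norm_num)]
  simp

theorem str_hypTorus {m n : ℕ} (a b : ℕ) (u : Fin m → ℂ) (v : Fin n → ℂ) :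
    (hypTorus a b u v).str = 0 := by
  have h := str_negAdj m a n b (hypTorus a b u v)
  rw [negAdj_hypTorus] at h
  linear_combination h / 2

/-! ### Detecting elements by weight vectors; regularity of the special linear types. -/

theorem SuperDatum.not_scalar_of_mkQ_ne_zero (X : SuperDatum) {x : X.alg}
    (hx : X.scalars.mkQ x ≠ 0) : ¬ ∃ c : ℂ, c • (1 : SMat X.P X.Q) = x.1 := by
  rwa [← X.mem_scalars_iff, ← Submodule.Quotient.mk_eq_zero]

/-- Vanishing in `𝔤` only makes the supercommutator a scalar matrix, but that still has zero
off-diagonal entries, and the entry at `(i, j)` is `(h i i - h j j) * x i j`. -/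
theorem SuperDatum.off_diag_of_gBr_eq_zero (X : SuperDatum) {h x : X.alg} (hh : h.1.IsDiag)
    (h0 : X.gBr (X.scalars.mkQ h) (X.scalars.mkQ x) = 0) {i j : X.P ⊕ X.Q} (hij : i ≠ j)
    (hne : h.1 i i ≠ h.1 j j) : x.1 i j = 0 := by
  rw [gBr_mkQ, Submodule.mkQ_apply, Submodule.Quotient.mk_eq_zero, X.mem_scalars_iff] at h0
  obtain ⟨c, hc⟩ := h0
  have h1 : (c • (1 : SMat X.P X.Q)) i j = SMat.sbr h.1 x.1 i j := congrFun (congrFun hc i) j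
  rw [Matrix.smul_apply, Matrix.one_apply_ne hij, smul_zero, SMat.sbr_apply_of_isDiag hh] at h1
  exact (mul_eq_zero.1 h1.symm).resolve_left (sub_ne_zero.2 hne)

theorem SMat.exists_weight_vector_sl {P Q : Type} [Fintype P] [Fintype Q] [DecidableEq P]
    [DecidableEq Q] {x : SMat P Q} (hx : ¬ ∃ c : ℂ, c • (1 : SMat P Q) = x) :
    ∃ p, ∃ y ∈ part p, y.str = 0 ∧ (∀ h : SMat P Q, h.IsDiag → ∃ c : ℂ, sbr h y = c • y) ∧
      str (x * y) ≠ 0 := by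
  by_cases hd : x.IsDiag
  · obtain ⟨i, j, hij⟩ : ∃ i j, x i i ≠ x j j := by
      by_contra! hall
      apply hx
      rcases isEmpty_or_nonempty (P ⊕ Q) with he | ⟨⟨i⟩⟩
      · exact ⟨0, Subsingleton.elim _ _⟩
      · refine ⟨x i i, ?_⟩
        rw [← hd.diagonal_diag, Matrix.smul_one_eq_diagonal]
        congr 1
        ext j
        simpa using hall i j
    -- The entries `sgn i`, `sgn j` cancel the signs of the supertrace: pairing with `d` gives `g i
    -- - g j`, which is zero for the identity matrix and nonzero for `x`.
    set d : P ⊕ Q → ℂ := Pi.single i (sgn i) - Pi.single j (sgn j) with hdd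
    have hsum (g : P ⊕ Q → ℂ) : ∑ p, sgn p * (g p * d p) = g i - g j := by
      simp only [hdd, Pi.sub_apply, mul_sub, Finset.sum_sub_distrib]
      rw [Finset.sum_eq_single i, Finset.sum_eq_single j]
      · simp only [Pi.single_eq_same]
        linear_combination g i * sgn_mul_self i - g j * sgn_mul_self j
      · intro p _ hp
        simp [hp]
      · simp
      · intro p _ hp
        simp [hp]
      · simp
    refine ⟨0, Matrix.diagonal d, isDiag_mem_part_zero (Matrix.isDiag_diagonal d), ?_, ?_, ?_⟩
    · have h1 := str_mul_diagonal 1 d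
      rw [Matrix.one_mul] at h1
      refine h1.trans ((hsum fun p => (1 : SMat P Q) p p).trans ?_)
      simp
    · intro h hh
      refine ⟨0, ?_⟩
      ext p q
      rw [sbr_apply_of_isDiag hh]
      by_cases hpq : p = q
      · simp [hpq]
      · simp [hpq]
    · rw [str_mul_diagonal, hsum fun p => x p p]
      exact sub_ne_zero.2 hij
  · obtain ⟨i, j, hij, hne⟩ : ∃ i j, i ≠ j ∧ x i j ≠ 0 := by
      by_contra! hall
      exact hd fun i j hij => hall i j hij
    obtain ⟨p, hp⟩ := exists_single_mem_part j i
    refine ⟨p, _, hp, ?_, fun h hh => ⟨_, sbr_single_of_isDiag hh j i⟩, ?_⟩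
    · rw [← Matrix.one_mul (Matrix.single j i (1 : ℂ)), str_mul_single, Matrix.one_apply_ne hij,
        mul_zero]
    · rw [str_mul_single]
      exact mul_ne_zero (sgn_ne_zero i) hne

theorem exists_weight_vector_osp {m n : ℕ} {x : SMat (HIdx m 0) (HIdx n 0)}
    (hfix : negAdj m 0 n 0 x = x) (hx : x ≠ 0) :
    ∃ p, ∃ y ∈ SMat.part p, negAdj m 0 n 0 y = y ∧
      (∀ h : SMat (HIdx m 0) (HIdx n 0), h.IsDiag → negAdj m 0 n 0 h = h →
        ∃ c : ℂ, SMat.sbr h y = c • y) ∧ SMat.str (x * y) ≠ 0 := by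
  obtain ⟨i, j, hne⟩ : ∃ i j, x i j ≠ 0 := by
    by_contra! hall
    exact hx (Matrix.ext hall)
  obtain ⟨p, hp⟩ := SMat.exists_single_mem_part j i
  -- Symmetrize the matrix unit at `(j, i)` under the involution `negAdj`. As `x` is fixed and the
  -- form invariant, both summands pair equally with `x`; as `h` is fixed, both have the same
  -- weight.
  refine ⟨p, _, SMat.add_mem_part hp (negAdj_mem_part m 0 n 0 p hp), ?_, ?_, ?_⟩
  · rw [map_add, negAdj_negAdj_of_eq_zero, add_comm]
  · intro h hh hhfix
    refine ⟨h j j - h i i, ?_⟩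
    rw [SMat.sbr_add_right, smul_add, ← map_smul, ← SMat.sbr_single_of_isDiag hh, negAdj_sbr, hhfix]
  · have h1 := str_negAdj_mul m 0 n 0 x (Matrix.single j i (1 : ℂ))
    rw [hfix] at h1
    rw [Matrix.mul_add, SMat.str_add, h1, ← two_mul, SMat.str_mul_single]
    exact mul_ne_zero two_ne_zero (mul_ne_zero (SMat.sgn_ne_zero i) hne)

theorem hypTorus_apply_self {m n : ℕ} (a b : ℕ) (u : Fin m → ℂ) (v : Fin n → ℂ) (i) :
    hypTorus a b u v i i = Sum.elim (hypDiag a u) (hypDiag b v) i :=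
  Matrix.diagonal_apply_eq _ _

theorem slDatum_isRegular (m a n b o : ℕ) (ha : a ≤ 1) (hb : b ≤ 1)
    (ho : o = 2 ∧ b = 0 ∨ o = 4) : (slDatum m a n b o).IsRegular where
  n_pos := by
    change 0 < o
    omega
  gσ_pow := by
    change (slDatum m a n b o).gσ ^ o = 1
    refine LinearMap.ext fun x => ?_
    obtain ⟨x, rfl⟩ := (slDatum m a n b o).scalars.mkQ_surjective x
    rcases ho with ⟨rfl, rfl⟩ | rfl
    · exact congrArg _ (Subtype.ext (negAdj_negAdj_of_eq_zero m a n x.1))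
    · exact congrArg _ (Subtype.ext (negAdj_pow_four m a n b x.1))
  gForm_gσ x y := by
    obtain ⟨x, rfl⟩ := (slDatum m a n b o).scalars.mkQ_surjective x
    obtain ⟨y, rfl⟩ := (slDatum m a n b o).scalars.mkQ_surjective y
    exact str_negAdj_mul m a n b x.1 y.1
  gσ_mem_gPart := by
    rintro i _ ⟨x, hx, rfl⟩
    exact ⟨_, negAdj_mem_part m a n b i hx, rfl⟩
  exists_weight_vector x hx := by
    obtain ⟨x, rfl⟩ := (slDatum m a n b o).scalars.mkQ_surjective x
    obtain ⟨p, y, hyp, hy, hw, hne⟩ :=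
      SMat.exists_weight_vector_sl ((slDatum m a n b o).not_scalar_of_mkQ_ne_zero hx)
    refine ⟨p, _, ⟨⟨y, hy⟩, hyp, rfl⟩, ?_, hne⟩
    rintro _ ⟨h, hh, rfl⟩
    obtain ⟨c, hc⟩ := hw h.1 hh
    exact ⟨c, congrArg _ (Subtype.ext hc)⟩
  mem_gCartan_of_centralizes := by
    rintro _ ⟨x, hx, rfl⟩ hc
    refine ⟨x, ?_, rfl⟩
    have key (u v) {i j : (slDatum m a n b o).P ⊕ (slDatum m a n b o).Q} (hij : i ≠ j)
        (hne : Sum.elim (hypDiag a u) (hypDiag b v) i ≠ Sum.elim (hypDiag a u) (hypDiag b v) j) :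
        x.1 i j = 0 := by
      refine (slDatum m a n b o).off_diag_of_gBr_eq_zero
        (h := ⟨hypTorus a b u v, str_hypTorus a b u v⟩) (hypTorus_isDiag a b u v)
        (hc _ ⟨_, hypTorus_isDiag a b u v, rfl⟩ ?_) hij
        fun h => hne ((hypTorus_apply_self a b u v i).symm.trans
          (h.trans (hypTorus_apply_self a b u v j)))
      exact congrArg _ (Subtype.ext (negAdj_hypTorus a b u v))
    -- Evenness, not weights, must dispose of the off-diagonal blocks: for `a = b = 1` the two
    -- unpaired basis vectors, one even and one odd, both have torus weight zero.
    have hx0 := (SMat.part_zero_iff _).1 hx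
    rintro (i | i) (j | j) hij
    · obtain ⟨w, hw⟩ := exists_hypDiag_ne ha (fun h => hij (congrArg _ h) : i ≠ j)
      exact key w 0 hij hw
    · exact congrFun (congrFun hx0 (Sum.inl i)) (Sum.inr j)
    · exact congrFun (congrFun hx0 (Sum.inr i)) (Sum.inl j)
    · obtain ⟨w, hw⟩ := exists_hypDiag_ne hb (fun h => hij (congrArg _ h) : i ≠ j)
      exact key 0 w hij hw

/-! ### Regularity of the orthosymplectic type. -/

/-- The torus fixed by the reflection has last coordinate zero, so it cannot separate the two
vectors of the last pair. Two indices from different pairs are separated by a coordinate that is not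
the last one; indices forming a pair are left to `osp_pair_eq_zero`. -/
theorem exists_hypDiag_ne_or_pair {k : ℕ} {i j : HIdx (k + 1) 0} (hij : i ≠ j) :
    (∃ w : Fin (k + 1) → ℂ, w (Fin.last k) = 0 ∧ hypDiag 0 w i ≠ hypDiag 0 w j) ∨
      ∃ p : Fin (k + 1), i = Sum.inl (Sum.inl p) ∧ j = Sum.inl (Sum.inr p) ∨
        i = Sum.inl (Sum.inr p) ∧ j = Sum.inl (Sum.inl p) := by
  have key : ∀ p q : Fin (k + 1), p ≠ q → ∀ s t : ℂ, s ≠ 0 → t ≠ 0 →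
      ∃ w : Fin (k + 1) → ℂ, w (Fin.last k) = 0 ∧ s * w p ≠ t * w q := by
    intro p q hpq s t hs ht
    by_cases hp : p = Fin.last k
    · refine ⟨Pi.single q 1, ?_, ?_⟩
      · rw [Pi.single_eq_of_ne (hp ▸ hpq)]
      · simpa [hpq] using ht.symm
    · refine ⟨Pi.single p 1, ?_, ?_⟩
      · rw [Pi.single_eq_of_ne (Ne.symm hp)]
      · simpa [hpq.symm] using hs
  have h1 : (-1 : ℂ) ≠ 0 := by norm_num
  rcases i with (i | i) | i <;> rcases j with (j | j) | j
  · refine Or.inl ?_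
    simpa [hypDiag] using
      key i j (fun h => hij (by rw [h])) 1 1 one_ne_zero one_ne_zero
  · by_cases h : i = j
    · exact Or.inr ⟨i, Or.inl ⟨rfl, by rw [h]⟩⟩
    · exact Or.inl (by simpa [hypDiag] using key i j h 1 (-1) one_ne_zero h1)
  · exact j.elim0
  · by_cases h : i = j
    · exact Or.inr ⟨i, Or.inr ⟨rfl, by rw [h]⟩⟩
    · exact Or.inl (by simpa [hypDiag] using key i j h (-1) 1 h1 one_ne_zero)
  · refine Or.inl ?_
    simpa [hypDiag] using
      key i j (fun h => hij (by rw [h])) (-1) (-1) h1 h1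
  · exact j.elim0
  · exact i.elim0
  · exact i.elim0
  · exact i.elim0

theorem conjSwap_conjSwap (k l : ℕ) (x : SMat (HIdx (k + 1) 0) (HIdx l 0)) :
    conjSwap k l (conjSwap k l x) = x := by
  have h (i) : lastSwap k l (lastSwap k l i) = i := by
    rcases i with i | i
    · exact congrArg Sum.inl (DFunLike.congr_fun (Equiv.swap_mul_self _ _) i)
    · rfl
  ext i j
  change x (lastSwap k l (lastSwap k l i)) (lastSwap k l (lastSwap k l j)) = x i j
  rw [h, h]

theorem str_conjSwap_mul (k l : ℕ) (x y : SMat (HIdx (k + 1) 0) (HIdx l 0)) :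
    SMat.str (conjSwap k l x * conjSwap k l y) = SMat.str (x * y) := by
  have hs (i) : SMat.sgn (lastSwap k l i) = SMat.sgn i := by
    rcases i with i | i <;> rfl
  have hm : conjSwap k l x * conjSwap k l y =
      (x * y).submatrix (lastSwap k l) (lastSwap k l) :=
    Matrix.submatrix_mul_equiv x y (lastSwap k l) (lastSwap k l) (lastSwap k l)
  rw [hm, SMat.str_eq_sum, SMat.str_eq_sum,
    ← Equiv.sum_comp (lastSwap k l) fun i => SMat.sgn i * (x * y) i i]
  exact Finset.sum_congr rfl fun i _ => by rw [hs]; rfl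

theorem conjSwap_mem_part (k l : ℕ) (i : ZMod 2) {x : SMat (HIdx (k + 1) 0) (HIdx l 0)}
    (hx : x ∈ SMat.part i) : conjSwap k l x ∈ SMat.part i := by
  obtain ⟨A, B, C, D, rfl⟩ := SMat.exists_blocks x
  rw [conjSwap_fromBlocks k l _ _ _ _ _ rfl]
  fin_cases i
  · obtain ⟨rfl, rfl⟩ := (SMat.fromBlocks_mem_part_zero _ _ _ _).1 hx
    exact (SMat.fromBlocks_mem_part_zero _ _ _ _).2 ⟨rfl, rfl⟩
  · obtain ⟨rfl, rfl⟩ := (SMat.fromBlocks_mem_part_one _ _ _ _).1 hx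
    exact (SMat.fromBlocks_mem_part_one _ _ _ _).2 ⟨rfl, rfl⟩

theorem conjSwap_hypTorus {k l : ℕ} (u : Fin (k + 1) → ℂ) (v : Fin l → ℂ)
    (hu : u (Fin.last k) = 0) : conjSwap k l (hypTorus 0 0 u v) = hypTorus 0 0 u v := by
  change (hypTorus 0 0 u v).submatrix (lastSwap k l) (lastSwap k l) = _
  rw [hypTorus, Matrix.submatrix_diagonal_equiv]
  congr 1
  ext (i | i)
  · change hypDiag 0 u (Equiv.swap _ _ i) = hypDiag 0 u i
    rw [Equiv.swap_apply_def]
    split_ifs with h1 h2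
    · simp [h1, hypDiag, hu]
    · simp [h2, hypDiag, hu]
    · rfl
  · rfl

/-- The even orthogonal block is skew with respect to the hyperbolic form, so each of these entries
equals its own negative; equivalently, `±2ε_p` are not roots of the orthogonal algebra. -/
theorem osp_pair_eq_zero {m n : ℕ} {x : SMat (HIdx m 0) (HIdx n 0)}
    (hx : negAdj m 0 n 0 x = x) (p : Fin m) :
    x (Sum.inl (Sum.inl (Sum.inl p))) (Sum.inl (Sum.inl (Sum.inr p))) = 0 ∧
      x (Sum.inl (Sum.inl (Sum.inr p))) (Sum.inl (Sum.inl (Sum.inl p))) = 0 := by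
  obtain ⟨A, B, C, D, rfl⟩ := SMat.exists_blocks x
  rw [negAdj_fromBlocks, Matrix.fromBlocks_inj] at hx
  obtain ⟨A', A₂, A₃, A₄, rfl⟩ : ∃ E F G H, A = Matrix.fromBlocks E F G H :=
    ⟨_, _, _, _, (Matrix.fromBlocks_toBlocks A).symm⟩
  obtain ⟨E, F, G, H, rfl⟩ : ∃ E F G H, A' = Matrix.fromBlocks E F G H :=
    ⟨_, _, _, _, (Matrix.fromBlocks_toBlocks A').symm⟩
  have h := hx.1
  simp [hypForm, Matrix.fromBlocks_multiply, Matrix.fromBlocks_transpose,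
    Matrix.fromBlocks_neg, Matrix.fromBlocks_inj] at h
  obtain ⟨⟨-, h12, h21, -⟩, -⟩ := h
  have h12 := congrFun (congrFun h12 p) p
  have h21 := congrFun (congrFun h21 p) p
  rw [Matrix.neg_apply, Matrix.transpose_apply] at h12 h21
  constructor
  · change F p p = 0
    linear_combination -h12 / 2
  · change G p p = 0
    linear_combination -h21 / 2

theorem ospDatum_isRegular (k l : ℕ) : (ospDatum k l).IsRegular where
  n_pos := two_pos
  gσ_pow := by
    change (ospDatum k l).gσ ^ 2 = 1
    refine LinearMap.ext fun x => ?_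
    obtain ⟨x, rfl⟩ := (ospDatum k l).scalars.mkQ_surjective x
    exact congrArg _ (Subtype.ext (conjSwap_conjSwap k l x.1))
  gForm_gσ x y := by
    obtain ⟨x, rfl⟩ := (ospDatum k l).scalars.mkQ_surjective x
    obtain ⟨y, rfl⟩ := (ospDatum k l).scalars.mkQ_surjective y
    exact str_conjSwap_mul k l x.1 y.1
  gσ_mem_gPart := by
    rintro i _ ⟨x, hx, rfl⟩
    exact ⟨_, conjSwap_mem_part k l i hx, rfl⟩
  exists_weight_vector x hx := by
    obtain ⟨x, rfl⟩ := (ospDatum k l).scalars.mkQ_surjective x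
    obtain ⟨p, y, hyp, hy, hw, hne⟩ := exists_weight_vector_osp x.2 fun h => hx (by
      rw [show x = 0 from Subtype.ext h, map_zero])
    refine ⟨p, _, ⟨⟨y, hy⟩, hyp, rfl⟩, ?_, hne⟩
    rintro _ ⟨h, hh, rfl⟩
    obtain ⟨c, hc⟩ := hw h.1 hh h.2
    exact ⟨c, congrArg _ (Subtype.ext hc)⟩
  mem_gCartan_of_centralizes := by
    rintro _ ⟨x, hx, rfl⟩ hc
    refine ⟨x, ?_, rfl⟩
    have key (u v) (hu : u (Fin.last k) = 0) {i j : (ospDatum k l).P ⊕ (ospDatum k l).Q}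
        (hij : i ≠ j) (hne : Sum.elim (hypDiag 0 u) (hypDiag 0 v) i ≠
          Sum.elim (hypDiag 0 u) (hypDiag 0 v) j) : x.1 i j = 0 := by
      refine (ospDatum k l).off_diag_of_gBr_eq_zero
        (h := ⟨hypTorus 0 0 u v, negAdj_hypTorus 0 0 u v⟩) (hypTorus_isDiag 0 0 u v)
        (hc _ ⟨_, hypTorus_isDiag 0 0 u v, rfl⟩ ?_) hij
        fun h => hne ((hypTorus_apply_self 0 0 u v i).symm.trans
          (h.trans (hypTorus_apply_self 0 0 u v j)))
      exact congrArg _ (Subtype.ext (conjSwap_hypTorus u v hu))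
    have hx0 := (SMat.part_zero_iff _).1 hx
    rintro (i | i) (j | j) hij
    · rcases exists_hypDiag_ne_or_pair (fun h => hij (congrArg _ h) : i ≠ j) with
        ⟨w, hw0, hw⟩ | ⟨p, ⟨rfl, rfl⟩ | ⟨rfl, rfl⟩⟩
      · exact key w 0 hw0 hij hw
      · exact (osp_pair_eq_zero x.2 p).1
      · exact (osp_pair_eq_zero x.2 p).2
    · exact congrFun (congrFun hx0 (Sum.inl i)) (Sum.inr j)
    · exact congrFun (congrFun hx0 (Sum.inr i)) (Sum.inl j)
    · obtain ⟨w, hw⟩ := exists_hypDiag_ne zero_le_one (fun h => hij (congrArg _ h) : i ≠ j)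
      exact key 0 w rfl hij hw

theorem TwistedType.datum_isRegular (T : TwistedType) : T.datum.IsRegular := by
  rcases T with ⟨k, l, hl⟩ | ⟨k, l, hk, hl, hkl⟩ | ⟨k, l, hl⟩ | ⟨k, l, hl⟩
  · exact slDatum_isRegular k 1 l 0 2 le_rfl zero_le_one (Or.inl ⟨rfl, rfl⟩)
  · exact slDatum_isRegular k 0 l 0 2 zero_le_one zero_le_one (Or.inl ⟨rfl, rfl⟩)
  · exact slDatum_isRegular k 1 l 1 4 le_rfl le_rfl (Or.inr rfl)
  · exact ospDatum_isRegular k l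

namespace SuperDatum

variable (X : SuperDatum)

/-! ## Duality of weight spaces -/

theorem gBr_eq_zero_of_mem_gCartan {h x : X.G} (hh : h ∈ X.gCartan) (hx : x ∈ X.gCartan) :
    X.gBr h x = 0 := by
  obtain ⟨a, ha, rfl⟩ := X.mem_gCartan.1 hh
  obtain ⟨b, hb, rfl⟩ := X.mem_gCartan.1 hx
  refine (congrArg X.scalars.mkQ (Subtype.ext (Matrix.ext fun i j => ?_))).trans (map_zero _)
  change SMat.sbr a.1 b.1 i j = 0
  rw [SMat.sbr_apply_of_isDiag ha]
  by_cases hij : i = j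
  · simp [hij]
  · rw [hb hij, mul_zero]

theorem ζ_pow (hn : 0 < X.n) : X.ζ ^ X.n = 1 := by
  have : (X.n : ℂ) ≠ 0 := by exact_mod_cast hn.ne'
  rw [ζ, ← Complex.exp_nat_mul, mul_div_cancel₀ _ this, Complex.exp_two_pi_mul_I]

variable {X}

/-- Take a weight vector `y` that pairs nontrivially with `x` and average it over the powers of `σ`
to land in the right eigenspace. Invariance of the form makes every summand pair with `x` in the
same way, so the average survives, and it forces the weight to be opposite. -/
theorem IsRegular.exists_dual_vector (hX : X.IsRegular) {p : ℤ} {x : X.G}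
    (hx : X.gσ x = X.ζ ^ p • x) (hx0 : x ≠ 0) (φ : X.G → ℂ)
    (hφ : ∀ h ∈ X.gCartan, X.gσ h = h → X.gBr h x = φ h • x) :
    ∃ i, ∃ y ∈ X.gPart i, X.gσ y = X.ζ ^ (-p) • y ∧
      (∀ h ∈ X.gCartan, X.gσ h = h → X.gBr h y = (-φ h) • y) ∧ X.gForm x y ≠ 0 := by
  obtain ⟨i, y, hyi, hyw, hxy⟩ := hX.exists_weight_vector x hx0
  have hn : (X.n : ℂ) ≠ 0 := by exact_mod_cast hX.n_pos.ne'
  set g : ℕ → X.G := fun j => (X.ζ ^ p) ^ j • (X.gσ ^ j) y with hg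
  -- The summands are periodic, so `σ` rotates the sum up to the factor `ζ ^ (-p)`.
  have hgn : g X.n = g 0 := by
    simp only [hg, hX.gσ_pow, pow_zero]
    rw [← zpow_natCast, ← zpow_mul, mul_comm, zpow_mul, zpow_natCast, X.ζ_pow hX.n_pos, one_zpow]
  have hgpart (j : ℕ) : (X.gσ ^ j) y ∈ X.gPart i := by
    induction j with
    | zero => exact hyi
    | succ j ih =>
      rw [pow_succ', Module.End.mul_apply]
      exact hX.gσ_mem_gPart i _ ih
  have hform (j : ℕ) : X.gForm x (g j) = X.gForm x y := by
    induction j with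
    | zero => simp [hg]
    | succ j ih =>
      rw [← ih]
      simp only [hg]
      rw [map_smul, map_smul, ← hX.gForm_gσ x ((X.gσ ^ j) y), hx, map_smul, LinearMap.smul_apply,
        pow_succ, mul_smul, pow_succ', Module.End.mul_apply]
  have hweight (h : X.G) (hh : h ∈ X.gCartan) (hσ : X.gσ h = h) (j : ℕ) :
      X.gBr h ((X.gσ ^ j) y) = (-φ h) • (X.gσ ^ j) y := by
    induction j with
    | zero =>
      obtain ⟨c, hc⟩ := hyw h hh
      have h1 := X.gForm_gBr x h y
      rw [X.gBr_skew (X.gPart_zero_of_mem_gCartan hh), hφ h hh hσ, hc, map_neg, map_smul,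
        map_smul, LinearMap.neg_apply, LinearMap.smul_apply, smul_eq_mul, smul_eq_mul] at h1
      have h2 : c = -φ h := mul_right_cancel₀ hxy (by linear_combination -h1)
      rw [pow_zero, Module.End.one_apply, hc, h2]
    | succ j ih =>
      rw [pow_succ', Module.End.mul_apply, ← map_smul, ← ih, gσ_gBr, hσ]
  refine ⟨i, ∑ j ∈ Finset.range X.n, g j, ?_, ?_, ?_, ?_⟩
  · exact (X.gPartSubmodule i).sum_mem fun j _ => (X.gPartSubmodule i).smul_mem _ (hgpart j)
  · have h1 : X.gσ (∑ j ∈ Finset.range X.n, g j) =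
        X.ζ ^ (-p) • ∑ j ∈ Finset.range X.n, g (j + 1) := by
      rw [map_sum, Finset.smul_sum]
      refine Finset.sum_congr rfl fun j _ => ?_
      simp only [hg]
      rw [map_smul, pow_succ', pow_succ', Module.End.mul_apply, mul_smul, smul_smul (X.ζ ^ (-p)),
        ← zpow_add₀ X.ζ_ne_zero, neg_add_cancel, zpow_zero, one_smul]
    have h2 := Finset.sum_range_succ g X.n
    rw [Finset.sum_range_succ', hgn] at h2
    rw [h1, add_right_cancel h2]
  · intro h hh hσ
    rw [map_sum, Finset.smul_sum]
    refine Finset.sum_congr rfl fun j _ => ?_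
    simp only [hg]
    rw [map_smul, hweight h hh hσ, smul_comm]
  · rw [map_sum, Finset.sum_congr rfl fun j _ => hform j, Finset.sum_const, Finset.card_range,
      nsmul_eq_mul]
    exact mul_ne_zero hn hxy

/-! ## Homogeneous elements of the twisted affine Lie superalgebra -/

theorem sum_single_apply (T : ℤ → X.G →ₗ[ℂ] X.G) (g : ℤ →₀ X.G) (p : ℤ) :
    (g.sum fun q y => Finsupp.single q (T q y)) p = T p (g p) := by
  rw [Finsupp.sum, Finsupp.finsetSum_apply, Finset.sum_eq_single p]
  · simp
  · intro q _ hq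
    simp [hq.symm]
  · intro hp
    rw [Finsupp.notMem_support_iff.1 hp]
    simp

/-- The coefficient of `t⁰` of an element of the Cartan subalgebra of `𝔏`. -/
abbrev cartanPart (h : X.affCartan) : X.G := h.1.1.1 0

theorem cartanPart_mem (h : X.affCartan) : cartanPart h ∈ X.gCartan := h.2.2

theorem gσ_cartanPart (h : X.affCartan) : X.gσ (cartanPart h) = cartanPart h := by
  simpa using h.1.1.2 0

theorem cartan_loop_eq (h : X.affCartan) : h.1.1.1 = Finsupp.single 0 (cartanPart h) := by
  ext p
  by_cases hp : p = 0
  · simp [hp]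
  · rw [h.2.1 p hp, Finsupp.single_eq_of_ne hp]

theorem affBr_cartan_apply (h : X.affCartan) (x : X.Aff) (p : ℤ) :
    (X.affBr h x).1.1 p = X.gBr (cartanPart h) (x.1.1 p) + (h.1.2.2 * p) • x.1.1 p := by
  have h1 : (X.loopBr h.1.1 x.1).1 p = X.gBr (cartanPart h) (x.1.1 p) := by
    change (h.1.1.1.sum fun p x' => x.1.1.sum fun q y => Finsupp.single (p + q) (X.gBr x' y)) p = _
    rw [cartan_loop_eq, Finsupp.sum_single_index (by simp)]
    simp only [zero_add]
    exact sum_single_apply (fun _ => X.gBr (cartanPart h)) x.1.1 p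
  have h2 (f : X.loop) : (X.loopDer f).1 p = (p : ℂ) • f.1 p :=
    sum_single_apply (fun p : ℤ => (p : ℂ) • (LinearMap.id : X.G →ₗ[ℂ] X.G)) f.1 p
  have h3 : (X.loopDer h.1.1).1 p = 0 := by
    rw [h2]
    by_cases hp : p = 0
    · simp [hp]
    · rw [h.2.1 p hp, smul_zero]
  change (X.loopBr h.1.1 x.1).1 p + h.1.2.2 • (X.loopDer x.1).1 p -
    x.2.2 • (X.loopDer h.1.1).1 p = _
  rw [h1, h2, h3, smul_zero, sub_zero, smul_smul]

theorem affBr_cartan_snd (h : X.affCartan) (x : X.Aff) : (X.affBr h x).2 = 0 := by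
  have h1 : X.loopCocycle h.1.1 x.1 = 0 := by
    rw [loopCocycle, cartan_loop_eq, Finsupp.sum_single_index (by simp)]
    simp
  exact Prod.ext h1 rfl

theorem mem_rootSpace_iff {α : X.CartanDual} {x : X.Aff} : x ∈ X.rootSpace α ↔
    ∀ h : X.affCartan, (∀ p, X.gBr (cartanPart h) (x.1.1 p) + (h.1.2.2 * p) • x.1.1 p =
      α h • x.1.1 p) ∧ α h • x.2 = 0 := by
  refine forall_congr' fun h => ?_
  constructor
  · intro hx
    refine ⟨fun p => ?_, ?_⟩
    · rw [← affBr_cartan_apply, hx]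
      rfl
    · rw [← affBr_cartan_snd h x, hx]
      rfl
  · rintro ⟨h1, h2⟩
    refine Prod.ext (Subtype.ext (Finsupp.ext fun p => ?_)) ?_
    · rw [affBr_cartan_apply, h1]
      rfl
    · rw [affBr_cartan_snd]
      exact h2.symm

/-- The element `x ⊗ tᵖ` of `𝔏`. -/
noncomputable def homog (p : ℤ) (x : X.G) (hx : X.gσ x = X.ζ ^ p • x) : X.Aff :=
  (⟨Finsupp.single p x, X.single_mem_loop p x hx⟩, 0, 0)

theorem homog_mem_rootSpace_iff {α : X.CartanDual} {p : ℤ} {x : X.G}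
    {hx : X.gσ x = X.ζ ^ p • x} : homog p x hx ∈ X.rootSpace α ↔
      ∀ h : X.affCartan, X.gBr (cartanPart h) x + (h.1.2.2 * p) • x = α h • x := by
  rw [mem_rootSpace_iff]
  refine forall_congr' fun h => ⟨fun h1 => ?_, fun h1 => ⟨fun q => ?_, smul_zero _⟩⟩
  · simpa [homog] using h1.1 p
  · by_cases hq : q = p
    · subst hq
      simpa [homog] using h1
    · simp [homog, Finsupp.single_eq_of_ne hq]

theorem homog_ne_zero {p : ℤ} {x : X.G} {hx : X.gσ x = X.ζ ^ p • x} (hx0 : x ≠ 0) :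
    homog p x hx ≠ 0 := by
  intro h
  have h1 : (homog p x hx).1.1 p = 0 := by rw [h]; rfl
  exact hx0 (by simpa [homog] using h1)

theorem homog_mem_affPart {i : ZMod 2} {p : ℤ} {x : X.G} {hx : X.gσ x = X.ζ ^ p • x}
    (hxi : x ∈ X.gPart i) : homog p x hx ∈ X.affPart i := by
  refine ⟨fun q => ?_, fun _ => rfl⟩
  by_cases hq : q = p
  · subst hq
    simpa [homog] using hxi
  · have h0 : (homog p x hx).1.1 q = 0 := Finsupp.single_eq_of_ne hq
    rw [h0]
    exact (X.gPartSubmodule i).zero_mem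

variable (X) in
/-- The central element `c` of the Cartan subalgebra. -/
noncomputable def cElt : X.affCartan := ⟨(0, 1, 0), fun _ _ => rfl, X.gCartan.zero_mem⟩

theorem cartanPart_cElt : cartanPart X.cElt = 0 := rfl

theorem cElt_coe : (X.cElt).1.2 = (1, 0) := rfl

theorem cartanPart_dElt : cartanPart X.dElt = 0 := rfl

theorem dElt_coe : (X.dElt).1.2 = (0, 1) := rfl

/-- The element `c` is central, so it acts by zero on a root vector. -/
theorem apply_cElt_of_mem_roots {α : X.CartanDual} (hα : α ∈ X.roots) : α X.cElt = 0 := by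
  obtain ⟨x, hx, hx0⟩ := hα
  by_contra hne
  have h := mem_rootSpace_iff.1 hx X.cElt
  refine hx0 (Prod.ext (Subtype.ext (Finsupp.ext fun p => ?_)) ?_)
  · have h1 := h.1 p
    rw [cartanPart_cElt, cElt_coe] at h1
    have h2 : α X.cElt • x.1.1 p = 0 := by
      rw [← h1]
      simp
    exact (smul_eq_zero.1 h2).resolve_left hne
  · exact (smul_eq_zero.1 h.2).resolve_left hne

/-- Brackets with the Cartan subalgebra have no `c` or `d` component, so neither does a vector of
nonzero weight; and `d` acts on `tᵖ` by `p`, so only the degree `p = α d` occurs. -/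
theorem exists_homog_of_mem_rootSpace {α : X.CartanDual} (hα : α ≠ 0) {x : X.Aff}
    (hx : x ∈ X.rootSpace α) (hx0 : x ≠ 0) : ∃ p y hy, x = homog p y hy ∧ y ≠ 0 := by
  have hx' := mem_rootSpace_iff.1 hx
  obtain ⟨h, hh⟩ : ∃ h, α h ≠ 0 := by
    by_contra! h
    exact hα (LinearMap.ext h)
  have hx2 : x.2 = 0 := (smul_eq_zero.1 (hx' h).2).resolve_left hh
  obtain ⟨p, hp⟩ : ∃ p, x.1.1 p ≠ 0 := by
    by_contra! hall
    exact hx0 (Prod.ext (Subtype.ext (Finsupp.ext hall)) hx2)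
  have hd (q : ℤ) (hq : x.1.1 q ≠ 0) : (q : ℂ) = α X.dElt := by
    have h1 := (hx' X.dElt).1 q
    rw [cartanPart_dElt, dElt_coe, map_zero,
      LinearMap.zero_apply, zero_add, one_mul] at h1
    exact smul_left_injective ℂ hq h1
  refine ⟨p, x.1.1 p, x.1.2 p, Prod.ext (Subtype.ext (Finsupp.ext fun q => ?_)) hx2, hp⟩
  by_cases hqp : q = p
  · simp [homog, hqp]
  · have h0 : x.1.1 q = 0 := by
      by_contra hq
      exact hqp (by exact_mod_cast (hd q hq).trans (hd p hp).symm)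
    simp [homog, Finsupp.single_eq_of_ne hqp, h0]

variable (X) in
/-- The element `x + r c + s d` of the Cartan subalgebra of `𝔏`. -/
noncomputable def cartanElt (x : X.G) (hx : x ∈ X.gCartan) (hσ : X.gσ x = x) (r s : ℂ) :
    X.affCartan :=
  ⟨(⟨Finsupp.single 0 x, X.single_mem_loop 0 x (by simpa using hσ)⟩, r, s), fun p hp => by
    simp [Finsupp.single_eq_of_ne hp], by simpa using hx⟩

theorem cartanPart_cartanElt (x : X.G) (hx : x ∈ X.gCartan) (hσ : X.gσ x = x) (r s : ℂ) :
    cartanPart (X.cartanElt x hx hσ r s) = x :=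
  Finsupp.single_eq_same

theorem IsRegular.exists_opposite (hX : X.IsRegular) {α : X.CartanDual} {p : ℤ} {x : X.G}
    {hx : X.gσ x = X.ζ ^ p • x} (hα : homog p x hx ∈ X.rootSpace α) (hx0 : x ≠ 0) :
    ∃ y hy, homog (-p) y hy ∈ X.rootSpace (-α) ∧ X.gForm x y ≠ 0 ∧ y ≠ 0 ∧
      (∃ i, y ∈ X.gPart i) ∧ (x ∈ X.gPart 0 → y ∈ X.gPart 0) := by
  classical
  rw [homog_mem_rootSpace_iff] at hα
  obtain ⟨i, y, hyi, hyσ, hyw, hxy⟩ := hX.exists_dual_vector hx hx0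
    -- Only the values on the `σ`-fixed part of the Cartan subalgebra matter; the value zero
    -- elsewhere is a filler.
    (fun h => if H : h ∈ X.gCartan ∧ X.gσ h = h then α (X.cartanElt h H.1 H.2 0 0) else 0) (by
      intro h hh hσ
      rw [dif_pos ⟨hh, hσ⟩, ← hα, cartanPart_cartanElt]
      simp [cartanElt])
  have hw (h : X.affCartan) : X.gBr (cartanPart h) y = (h.1.2.2 * p - α h) • y := by
    have h1 := hyw _ (cartanPart_mem h) (gσ_cartanPart h)
    have h2 := X.gForm_gBr x (cartanPart h) y
    have h3 : X.gBr (cartanPart h) x = (α h - h.1.2.2 * p) • x := by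
      rw [sub_smul, ← hα, add_sub_cancel_right]
    rw [X.gBr_skew (X.gPart_zero_of_mem_gCartan (cartanPart_mem h)), h3, h1, map_neg, map_smul,
      map_smul, LinearMap.neg_apply, LinearMap.smul_apply, smul_eq_mul, smul_eq_mul] at h2
    rw [h1]
    congr 1
    exact mul_right_cancel₀ hxy (by linear_combination -h2)
  refine ⟨y, hyσ, ?_, hxy, fun h => hxy (by rw [h, map_zero]), ⟨i, hyi⟩, fun hx' => ?_⟩
  · rw [homog_mem_rootSpace_iff]
    intro h
    rw [hw, ← add_smul, LinearMap.neg_apply]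
    congr 1
    push_cast
    ring
  · fin_cases i
    · exact hyi
    · exact absurd (X.gForm_eq_zero hx' hyi) hxy

theorem IsRegular.neg_mem_roots (hX : X.IsRegular) {α : X.CartanDual} (hα : α ∈ X.roots) :
    -α ∈ X.roots := by
  by_cases h0 : α = 0
  · rwa [h0, neg_zero, ← h0]
  · obtain ⟨x, hx, hx0⟩ := hα
    obtain ⟨p, x, hxσ, rfl, hne⟩ := exists_homog_of_mem_rootSpace h0 hx hx0
    obtain ⟨y, hy, hyr, -, hy0, -⟩ := hX.exists_opposite hx hne
    exact ⟨_, hyr, homog_ne_zero hy0⟩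

/-! ## The form on the dual of the Cartan subalgebra -/

theorem affForm_cartan (h k : X.affCartan) : X.affForm h k =
    X.gForm (cartanPart h) (cartanPart k) + h.1.2.1 * k.1.2.2 + h.1.2.2 * k.1.2.1 := by
  rw [affForm, loopForm, cartan_loop_eq, Finsupp.sum_single_index (by simp), neg_zero]

theorem affForm_cartan_comm (h k : X.affCartan) : X.affForm h k = X.affForm k h := by
  rw [affForm_cartan, affForm_cartan,
    X.gForm_comm (X.gPart_zero_of_mem_gCartan (cartanPart_mem h))]
  ring

variable (X) in
/-- The invariant form on the Cartan subalgebra of `𝔏`. -/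
noncomputable def cartanForm : X.affCartan →ₗ[ℂ] Module.Dual ℂ X.affCartan :=
  LinearMap.mk₂ ℂ (fun h k => X.affForm h k)
    (fun h h' k => by
      simp only [affForm_cartan]
      change X.gForm (cartanPart h + cartanPart h') _ + (h.1.2.1 + h'.1.2.1) * _ +
        (h.1.2.2 + h'.1.2.2) * _ = _
      rw [map_add, LinearMap.add_apply]
      ring)
    (fun a h k => by
      simp only [affForm_cartan]
      change X.gForm (a • cartanPart h) _ + (a * h.1.2.1) * _ + (a * h.1.2.2) * _ = _
      rw [map_smul, LinearMap.smul_apply, smul_eq_mul, smul_eq_mul]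
      ring)
    (fun h k k' => by
      simp only [affForm_cartan]
      change X.gForm _ (cartanPart k + cartanPart k') + _ * (k.1.2.2 + k'.1.2.2) +
        _ * (k.1.2.1 + k'.1.2.1) = _
      rw [map_add]
      ring)
    (fun a h k => by
      simp only [affForm_cartan]
      change X.gForm _ (a • cartanPart k) + _ * (a * k.1.2.2) + _ * (a * k.1.2.1) = _
      rw [map_smul, smul_eq_mul, smul_eq_mul]
      ring)

noncomputable instance : AddCommGroup X.affCartan := Module.addCommMonoidToAddCommGroup ℂ

/-- Pairing with `c` and `d` kills the `d` and `c` components. A nonzero remainder in `𝔤` would have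
a dual vector that is even, `σ`-fixed and of weight zero, hence itself in the Cartan subalgebra. -/
theorem IsRegular.cartanForm_injective (hX : X.IsRegular) : Function.Injective X.cartanForm := by
  rw [injective_iff_map_eq_zero]
  intro h hh
  have hk (k : X.affCartan) :
      X.gForm (cartanPart h) (cartanPart k) + h.1.2.1 * k.1.2.2 + h.1.2.2 * k.1.2.1 = 0 := by
    rw [← affForm_cartan]
    exact DFunLike.congr_fun hh k
  have h1 : h.1.2.2 = 0 := by
    simpa [cartanPart_cElt, cElt_coe] using hk X.cElt
  have h2 : h.1.2.1 = 0 := by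
    simpa [cartanPart_dElt, dElt_coe] using hk X.dElt
  have h3 : cartanPart h = 0 := by
    by_contra hne
    obtain ⟨i, y, hyi, hyσ, hyw, hxy⟩ := hX.exists_dual_vector (p := 0)
      (by simpa using gσ_cartanPart h) hne (fun _ => 0) (fun k hk _ => by
        rw [zero_smul, X.gBr_eq_zero_of_mem_gCartan hk (cartanPart_mem h)])
    have hx0 := X.gPart_zero_of_mem_gCartan (cartanPart_mem h)
    have hi : i = 0 := by
      fin_cases i
      · rfl
      · exact absurd (X.gForm_eq_zero hx0 hyi) hxy
    subst hi
    have hyσ' : X.gσ y = y := by simpa using hyσ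
    have hyc : y ∈ X.gCartan := hX.mem_gCartan_of_centralizes y hyi fun k hk hσ => by
      simpa using hyw k hk hσ
    have h4 := hk (X.cartanElt y hyc hyσ' 0 0)
    rw [cartanPart_cartanElt, h1, h2] at h4
    exact hxy (by simpa using h4)
  refine Subtype.ext (Prod.ext (Subtype.ext ?_) (Prod.ext (h2 : _ = (0 : ℂ)) (h1 : _ = (0 : ℂ))))
  rw [cartan_loop_eq, h3, Finsupp.single_zero]
  rfl

instance : FiniteDimensional ℂ X.affCartan := by
  let F : X.affCartan →ₗ[ℂ] X.G × ℂ × ℂ :=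
    { toFun := fun h => (cartanPart h, h.1.2)
      map_add' := fun _ _ => rfl
      map_smul' := fun _ _ => rfl }
  refine FiniteDimensional.of_injective F fun h k hhk => ?_
  have h1 : cartanPart h = cartanPart k := congrArg (fun z : X.G × ℂ × ℂ => z.1) hhk
  have h2 : h.1.2 = k.1.2 := congrArg (fun z : X.G × ℂ × ℂ => z.2) hhk
  refine Subtype.ext (Prod.ext (Subtype.ext ?_) h2)
  rw [cartan_loop_eq, cartan_loop_eq, h1]

/-- An injective map between spaces of equal finite dimension is onto, so the choice in `tVec` is a
genuine one. -/
theorem IsRegular.affForm_tVec (hX : X.IsRegular) (α : X.CartanDual) (h : X.affCartan) :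
    X.affForm (X.tVec α) h = α h := by
  have hsurj : Function.Surjective X.cartanForm :=
    (LinearMap.injective_iff_surjective_of_finrank_eq_finrank
      Subspace.dual_finrank_eq.symm).1 hX.cartanForm_injective
  obtain ⟨t, ht⟩ := hsurj α
  exact Classical.epsilon_spec (p := fun t : X.affCartan => ∀ h : X.affCartan,
    X.affForm t h = α h) ⟨t, fun h => DFunLike.congr_fun ht h⟩ h

theorem IsRegular.dualForm_eq (hX : X.IsRegular) (α β : X.CartanDual) :
    X.dualForm α β = α (X.tVec β) := hX.affForm_tVec α _

theorem dualForm_comm (α β : X.CartanDual) : X.dualForm α β = X.dualForm β α :=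
  affForm_cartan_comm _ _

theorem IsRegular.dualForm_δ (hX : X.IsRegular) (α : X.CartanDual) :
    X.dualForm X.δ α = α X.cElt := by
  rw [hX.dualForm_eq, ← hX.affForm_tVec α, affForm_cartan]
  simp [δ, cartanPart_cElt, cElt_coe]

theorem IsRegular.neg_mem_realRootsNZ (hX : X.IsRegular) {α : X.CartanDual}
    (hα : α ∈ X.realRootsNZ) : -α ∈ X.realRootsNZ := by
  refine ⟨hX.neg_mem_roots hα.1, ?_⟩
  rw [hX.dualForm_eq, LinearMap.neg_apply, ← hX.dualForm_eq, dualForm_comm, hX.dualForm_eq,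
    LinearMap.neg_apply, ← hX.dualForm_eq, neg_neg]
  exact hα.2

/-! ## Brackets of root vectors -/

theorem affBr_homog {p q : ℤ} {x y : X.G} (hx : X.gσ x = X.ζ ^ p • x)
    (hy : X.gσ y = X.ζ ^ q • y) :
    (X.affBr (homog p x hx) (homog q y hy)).1.1 = Finsupp.single (p + q) (X.gBr x y) ∧
      (X.affBr (homog p x hx) (homog q y hy)).2 = (p * X.gForm x (Finsupp.single q y (-p)), 0) := by
  have h1 : (X.loopBr (homog p x hx).1 (homog q y hy).1).1 =
      Finsupp.single (p + q) (X.gBr x y) := by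
    change ((Finsupp.single p x).sum fun p x => (Finsupp.single q y).sum fun q y =>
      Finsupp.single (p + q) (X.gBr x y)) = _
    rw [Finsupp.sum_single_index (by simp), Finsupp.sum_single_index (by simp)]
  refine ⟨?_, ?_⟩
  · change (X.loopBr (homog p x hx).1 (homog q y hy).1).1 + (0 : ℂ) • _ - (0 : ℂ) • _ = _
    rw [h1, zero_smul, zero_smul, add_zero, sub_zero]
  · refine Prod.ext ?_ rfl
    change ((Finsupp.single p x).sum fun p x => (p : ℂ) * X.gForm x (Finsupp.single q y (-p))) = _
    rw [Finsupp.sum_single_index (by simp)]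

theorem affBr_homog_mem_rootSpace {α β : X.CartanDual} {p q : ℤ} {x y : X.G}
    {hx : X.gσ x = X.ζ ^ p • x} {hy : X.gσ y = X.ζ ^ q • y} (hxα : homog p x hx ∈ X.rootSpace α)
    (hyβ : homog q y hy ∈ X.rootSpace β) :
    X.affBr (homog p x hx) (homog q y hy) ∈ X.rootSpace (α + β) := by
  rw [homog_mem_rootSpace_iff] at hxα hyβ
  rw [mem_rootSpace_iff]
  obtain ⟨h1, h2⟩ := affBr_homog hx hy
  intro h
  have hxw : X.gBr (cartanPart h) x = (α h - h.1.2.2 * p) • x := by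
    rw [sub_smul, ← hxα, add_sub_cancel_right]
  have hyw : X.gBr (cartanPart h) y = (β h - h.1.2.2 * q) • y := by
    rw [sub_smul, ← hyβ, add_sub_cancel_right]
  have hh := X.gPart_zero_of_mem_gCartan (cartanPart_mem h)
  refine ⟨fun s => ?_, ?_⟩
  · rw [h1]
    by_cases hs : s = p + q
    · subst hs
      rw [Finsupp.single_eq_same, X.gBr_gBr hh, hxw, hyw, map_smul, map_smul,
        LinearMap.smul_apply, ← add_smul, ← add_smul, LinearMap.add_apply]
      congr 1
      push_cast
      ring
    · simp [Finsupp.single_eq_of_ne hs]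
  · rw [h2]
    refine Prod.ext ?_ (mul_zero _)
    change (α h + β h) * (p * X.gForm x (Finsupp.single q y (-p))) = 0
    -- The central term occurs only for `p + q = 0`; there invariance of the form gives `(α + β)(h)
    -- * (x, y) = 0`.
    by_cases hpq : -p = q
    · subst hpq
      have h3 := X.gForm_gBr x (cartanPart h) y
      rw [X.gBr_skew hh, hxw, hyw, map_neg, map_smul, map_smul, LinearMap.neg_apply,
        LinearMap.smul_apply, smul_eq_mul, smul_eq_mul] at h3
      rw [Finsupp.single_eq_same]
      push_cast at h3
      linear_combination -(p : ℂ) * h3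
    · rw [Finsupp.single_eq_of_ne hpq, map_zero, mul_zero, mul_zero]

theorem affBr_homog_eq_zero {α β : X.CartanDual} {p q : ℤ} {x y : X.G}
    {hx : X.gσ x = X.ζ ^ p • x} {hy : X.gσ y = X.ζ ^ q • y} (hxα : homog p x hx ∈ X.rootSpace α)
    (hyβ : homog q y hy ∈ X.rootSpace β) (hαβ : α + β ∉ X.roots) :
    X.affBr (homog p x hx) (homog q y hy) = 0 := by
  by_contra h
  exact hαβ ⟨_, affBr_homog_mem_rootSpace hxα hyβ, h⟩

/-- This is the identity `[x, y] = (x, y) t_α`, tested against functionals. The bracket lies in the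
Cartan subalgebra because it is even, `σ`-fixed and of weight zero. -/
theorem IsRegular.affBr_opposite (hX : X.IsRegular) {α : X.CartanDual} {p : ℤ} {x y : X.G}
    {hx : X.gσ x = X.ζ ^ p • x} {hy : X.gσ y = X.ζ ^ (-p) • y} (hx0 : x ∈ X.gPart 0)
    (hy0 : y ∈ X.gPart 0) (hxα : homog p x hx ∈ X.rootSpace α)
    (hyα : homog (-p) y hy ∈ X.rootSpace (-α)) :
    ∃ h : X.affCartan, X.affBr (homog p x hx) (homog (-p) y hy) = h ∧
      ∀ β : X.CartanDual, β h = X.gForm x y * X.dualForm β α := by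
  have hmem := affBr_homog_mem_rootSpace hxα hyα
  rw [add_neg_cancel, mem_rootSpace_iff] at hmem
  obtain ⟨h1, h2⟩ := affBr_homog hx hy
  rw [add_neg_cancel] at h1
  have hσ : X.gσ (X.gBr x y) = X.gBr x y := by
    rw [gσ_gBr, hx, hy, map_smul, map_smul, LinearMap.smul_apply, smul_smul,
      ← zpow_add₀ X.ζ_ne_zero, neg_add_cancel, zpow_zero, one_smul]
  have hc : X.gBr x y ∈ X.gCartan := by
    refine hX.mem_gCartan_of_centralizes _ (X.gBr_mem_gPart_zero hx0 hy0) fun h hh hhσ => ?_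
    have h3 := (hmem (X.cartanElt h hh hhσ 0 0)).1 0
    rw [h1, cartanPart_cartanElt] at h3
    simpa using h3
  have heq : X.affBr (homog p x hx) (homog (-p) y hy) =
      X.cartanElt _ hc hσ (p * X.gForm x y) 0 := by
    refine Prod.ext (Subtype.ext h1) (h2.trans ?_)
    rw [Finsupp.single_eq_same]
    rfl
  refine ⟨_, heq, fun β => ?_⟩
  rw [dualForm_comm, hX.dualForm_eq, ← hX.affForm_tVec β, affForm_cartan_comm]
  generalize X.tVec β = k
  rw [affForm_cartan, cartanPart_cartanElt]
  rw [homog_mem_rootSpace_iff] at hyα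
  have hyw : X.gBr (cartanPart k) y = (k.1.2.2 * p - α k) • y := by
    have h3 := hyα k
    rw [← eq_sub_iff_add_eq, ← sub_smul, LinearMap.neg_apply] at h3
    rw [h3]
    congr 1
    push_cast
    ring
  rw [X.gForm_gBr, X.gBr_skew (X.gPart_zero_of_mem_gCartan (cartanPart_mem k)), hyw, map_neg,
    map_smul, smul_eq_mul]
  simp only [cartanElt]
  ring

/-- A real root of the even part has an `sl₂`-triple of even root vectors. -/
theorem IsRegular.exists_sl2_triple (hX : X.IsRegular) {α : X.CartanDual}
    (hα : X.dualForm α α ≠ 0) (hα0 : α ∈ X.evenRoots) :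
    ∃ (p : ℤ) (x y : X.G) (hx : X.gσ x = X.ζ ^ p • x) (hy : X.gσ y = X.ζ ^ (-p) • y)
      (h : X.affCartan), x ∈ X.gPart 0 ∧ y ∈ X.gPart 0 ∧ x ≠ 0 ∧ y ≠ 0 ∧
        homog p x hx ∈ X.rootSpace α ∧ homog (-p) y hy ∈ X.rootSpace (-α) ∧
        X.affBr (homog p x hx) (homog (-p) y hy) = h ∧ α h = 2 ∧
        ∀ β, X.dualForm β α = 0 → β h = 0 := by
  have hne : α ≠ 0 := by
    rintro rfl
    exact hα (by rw [hX.dualForm_eq, LinearMap.zero_apply])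
  obtain ⟨x, hxα, hx0, hxne⟩ := hα0
  obtain ⟨p, x, hxσ, rfl, hne'⟩ := exists_homog_of_mem_rootSpace hne hxα hxne
  have hxp : x ∈ X.gPart 0 := by simpa [homog] using hx0.1 p
  obtain ⟨y, hyσ, hyα, hxy, hyne, -, hyp⟩ := hX.exists_opposite hxα hne'
  set a : ℂ := 2 / (X.gForm x y * X.dualForm α α) with ha
  have ha0 : a ≠ 0 := div_ne_zero two_ne_zero (mul_ne_zero hxy hα)
  have hyσ' : X.gσ (a • y) = X.ζ ^ (-p) • (a • y) := by rw [map_smul, hyσ, smul_comm]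
  have hyα' : homog (-p) (a • y) hyσ' ∈ X.rootSpace (-α) := by
    rw [homog_mem_rootSpace_iff] at hyα ⊢
    intro h
    rw [map_smul, smul_comm _ a, ← smul_add, hyα, smul_comm]
  have hyp' : a • y ∈ X.gPart 0 := (X.gPartSubmodule 0).smul_mem a (hyp hxp)
  obtain ⟨h, hh, hβ⟩ := hX.affBr_opposite hxp hyp' hxα hyα'
  refine ⟨p, x, a • y, hxσ, hyσ', h, hxp, hyp', hne', smul_ne_zero ha0 hyne, hxα, hyα', hh, ?_,
    fun β h0 => by rw [hβ, h0, mul_zero]⟩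
  rw [hβ, map_smul, smul_eq_mul, mul_assoc, ha, div_mul_cancel₀ _ (mul_ne_zero hxy hα)]

/-- A nonzero root has a root vector that is homogeneous for the parity. -/
theorem IsRegular.exists_parity_homog (hX : X.IsRegular) {α : X.CartanDual} (hα : α ≠ 0)
    (hαr : α ∈ X.roots) : ∃ (p : ℤ) (x : X.G) (hx : X.gσ x = X.ζ ^ p • x) (i : ZMod 2),
      x ≠ 0 ∧ x ∈ X.gPart i ∧ homog p x hx ∈ X.rootSpace α := by
  -- Going to `-α` and back gains parity: the vector supplied by `exists_opposite` is homogeneous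
  -- even when the given one is not.
  obtain ⟨x, hx, hx0⟩ := hX.neg_mem_roots hαr
  obtain ⟨p, x, hxσ, rfl, hne⟩ := exists_homog_of_mem_rootSpace (neg_ne_zero.2 hα) hx hx0
  obtain ⟨y, hyσ, hyα, -, hy0, ⟨i, hi⟩, -⟩ := hX.exists_opposite hx hne
  exact ⟨-p, y, hyσ, i, hy0, hi, by rwa [neg_neg] at hyα⟩

end SuperDatum

/-! ## Operators satisfying the relations of `sl₂` -/

section SL2

variable {M : Type*} [AddCommGroup M] [Module ℂ M] {e f h : Module.End ℂ M}

theorem h_pow_f_apply (hhf : h * f = f * h - 2 • f) {u : M} {η : ℂ} (hu : h u = η • u) (n : ℕ) :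
    h ((f ^ n) u) = (η - 2 * n) • (f ^ n) u := by
  induction n with
  | zero => simp [hu]
  | succ n ih =>
    rw [pow_succ', Module.End.mul_apply]
    have h1 := LinearMap.congr_fun hhf ((f ^ n) u)
    simp only [Module.End.mul_apply, LinearMap.sub_apply, LinearMap.smul_apply] at h1
    rw [h1, ih, map_smul, ← Nat.cast_smul_eq_nsmul ℂ 2, ← sub_smul]
    congr 1
    push_cast
    ring

theorem e_pow_f_succ_apply (hef : e * f = f * e + h) (hhf : h * f = f * h - 2 • f) {u : M} {η : ℂ}
    (hu : h u = η • u) (heu : e u = 0) (n : ℕ) :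
    e ((f ^ (n + 1)) u) = ((n + 1) * (η - n)) • (f ^ n) u := by
  have h2 (v : M) : e (f v) = f (e v) + h v := LinearMap.congr_fun hef v
  induction n with
  | zero => simp [h2, heu, hu]
  | succ n ih =>
    rw [pow_succ', Module.End.mul_apply, h2, ih, h_pow_f_apply hhf hu, map_smul,
      ← Module.End.mul_apply, ← pow_succ', ← add_smul]
    congr 1
    push_cast
    ring

/-- The result is `u` times the product of the factors `(i + 1) * (η - i)` over `i < n`. -/
theorem e_pow_f_pow_apply_ne_zero (hef : e * f = f * e + h) (hhf : h * f = f * h - 2 • f) {u : M}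
    {η : ℂ} (hu : h u = η • u) (heu : e u = 0) (hu0 : u ≠ 0) (n : ℕ) (hη : ∀ i < n, η ≠ i) :
    (e ^ n) ((f ^ n) u) ≠ 0 := by
  induction n with
  | zero => simpa using hu0
  | succ n ih =>
    rw [pow_succ, Module.End.mul_apply, e_pow_f_succ_apply hef hhf hu heu, map_smul]
    refine smul_ne_zero (mul_ne_zero (by exact_mod_cast n.succ_ne_zero) ?_)
      (ih fun i hi => hη i (by omega))
    exact sub_ne_zero.2 (hη n (by omega))

/-- If `e` is locally nilpotent, a vector of large weight can be pushed down by `f` to a vector on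
which a high power of `e` does not vanish. -/
theorem exists_e_pow_ne_zero (hef : e * f = f * e + h) (hhf : h * f = f * h - 2 • f)
    (hhe : h * e = e * h + 2 • e) (hnil : ∀ v, ∃ n, (e ^ n) v = 0) {w : M} (hw : w ≠ 0) {η : ℂ}
    (n : ℕ) (hwη : h w = (η + 2 * n) • w) (hn : ∀ m : ℕ, n ≤ m → ∀ i < m, η + 2 * m ≠ i) :
    ∃ a : ℕ, (e ^ n) ((f ^ (n + a)) ((e ^ a) w)) ≠ 0 := by
  classical
  have hex := hnil w
  obtain ⟨a, ha⟩ : ∃ a, Nat.find hex = a + 1 := by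
    refine Nat.exists_eq_succ_of_ne_zero fun h0 => hw ?_
    simpa [h0] using Nat.find_spec hex
  have hne : (e ^ a) w ≠ 0 := Nat.find_min hex (by omega)
  have hzero : e ((e ^ a) w) = 0 := by
    rw [← Module.End.mul_apply, ← pow_succ', ← ha]
    exact Nat.find_spec hex
  have hweight (b : ℕ) : h ((e ^ b) w) = (η + 2 * n + 2 * b) • (e ^ b) w := by
    induction b with
    | zero => simpa using hwη
    | succ b ih =>
      rw [pow_succ', Module.End.mul_apply]
      have h1 := LinearMap.congr_fun hhe ((e ^ b) w)
      simp only [Module.End.mul_apply, LinearMap.add_apply, LinearMap.smul_apply] at h1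
      rw [h1, ih, map_smul, ← Nat.cast_smul_eq_nsmul ℂ 2, ← add_smul]
      congr 1
      push_cast
      ring
  -- The vector `(e ^ a) w` is a highest weight vector of weight `η + 2(n + a)`, so `e ^ (n + a)`
  -- does not kill its image under `f ^ (n + a)`; a fortiori `e ^ n` does not.
  have hfinal := e_pow_f_pow_apply_ne_zero hef hhf (hweight a) hzero hne (n + a) fun i hi => by
    have := hn (n + a) (by omega) i hi
    push_cast at this
    rwa [mul_add, ← add_assoc] at this
  refine ⟨a, fun h0 => hfinal ?_⟩
  rw [add_comm n a, pow_add, Module.End.mul_apply, add_comm a n, h0, map_zero]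

end SL2

/-- Once `m > -Re η`, the real part of `η + 2m` exceeds `m`. -/
theorem eventually_ne_natCast (η : ℂ) :
    ∃ N : ℕ, ∀ m : ℕ, N ≤ m → ∀ i < m, η + 2 * m ≠ i := by
  obtain ⟨N, hN⟩ := exists_nat_gt (-η.re)
  refine ⟨N, fun m hm i hi h => ?_⟩
  have h1 := congrArg Complex.re h
  simp at h1
  have h2 : (N : ℝ) ≤ m := by exact_mod_cast hm
  have h3 : (i : ℝ) < m := by exact_mod_cast hi
  linarith

namespace SuperDatum

variable {X : SuperDatum} {M : Type*} [AddCommGroup M] [Module ℂ M]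
  {ρ : X.Aff →ₗ[ℂ] Module.End ℂ M}

/-! ## Representations -/

theorem cartan_mem_affPart (h : X.affCartan) : (h : X.Aff) ∈ X.affPart 0 := by
  refine ⟨fun p => ?_, fun h0 => absurd rfl h0⟩
  by_cases hp : p = 0
  · subst hp
    exact X.gPart_zero_of_mem_gCartan (cartanPart_mem h)
  · rw [h.2.1 p hp]
    exact (X.gPartSubmodule 0).zero_mem

theorem IsRep.even_mul (hρ : X.IsRep ρ) {x y : X.Aff} {j : ZMod 2} (hx : x ∈ X.affPart 0)
    (hy : y ∈ X.affPart j) : ρ x * ρ y = ρ y * ρ x + ρ (X.affBr x y) := by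
  rw [hρ 0 j x hx y hy]
  simp

theorem IsRep.cartan_mul (hρ : X.IsRep ρ) {α : X.CartanDual} {x : X.Aff} {j : ZMod 2}
    (hx : x ∈ X.rootSpace α) (hxj : x ∈ X.affPart j) (h : X.affCartan) :
    ρ h * ρ x = ρ x * ρ h + α h • ρ x := by
  rw [hρ.even_mul (cartan_mem_affPart h) hxj, hx h, map_smul]

theorem IsRep.apply_mem_weightSpace (hρ : X.IsRep ρ) {α μ : X.CartanDual} {x : X.Aff}
    {j : ZMod 2} (hx : x ∈ X.rootSpace α) (hxj : x ∈ X.affPart j) {v : M}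
    (hv : v ∈ X.weightSpace ρ μ) : ρ x v ∈ X.weightSpace ρ (μ + α) := by
  intro h
  have h1 := LinearMap.congr_fun (hρ.cartan_mul hx hxj h) v
  simp only [Module.End.mul_apply, LinearMap.add_apply, LinearMap.smul_apply] at h1
  rw [h1, hv h, map_smul, ← add_smul, LinearMap.add_apply]

theorem IsRep.pow_apply_mem_weightSpace (hρ : X.IsRep ρ) {α μ : X.CartanDual} {x : X.Aff}
    {j : ZMod 2} (hx : x ∈ X.rootSpace α) (hxj : x ∈ X.affPart j) {v : M}
    (hv : v ∈ X.weightSpace ρ μ) (n : ℕ) : (ρ x ^ n) v ∈ X.weightSpace ρ (μ + n • α) := by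
  induction n with
  | zero => simpa using hv
  | succ n ih =>
    rw [pow_succ', Module.End.mul_apply, succ_nsmul, ← add_assoc]
    exact hρ.apply_mem_weightSpace hx hxj ih

theorem mem_supp_iff {μ : X.CartanDual} : μ ∈ X.supp ρ ↔ ∃ v ∈ X.weightSpace ρ μ, v ≠ 0 :=
  Submodule.ne_bot_iff _

theorem add_nsmul_mem_supp {α μ : X.CartanDual} (hα : α ∈ X.setC ρ) (hμ : μ ∈ X.supp ρ) (n : ℕ) :
    μ + n • α ∈ X.supp ρ := by
  induction n with
  | zero => simpa using hμ
  | succ n ih =>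
    rw [succ_nsmul, ← add_assoc, add_comm _ α]
    exact hα.2 _ ih

/-- In a sequence of integers, some residue class modulo `q > 0` occurs infinitely often. -/
theorem exists_residue_frequently (s : ℕ → ℤ) {q : ℤ} (hq : 0 < q) :
    ∃ c : ℤ, {i | q ∣ c - s i}.Infinite := by
  obtain ⟨q, rfl⟩ := Int.eq_ofNat_of_zero_le hq.le
  have : NeZero q := ⟨by rintro rfl; simp at hq⟩
  obtain ⟨a, ha⟩ := Finite.exists_infinite_fiber fun i => (s i : ZMod q)
  obtain ⟨c, rfl⟩ := ZMod.intCast_surjective a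
  refine ⟨c, (Set.infinite_coe_iff.1 ha).mono fun i hi => ?_⟩
  have h1 : ((s i : ℤ) : ZMod q) = c := hi
  exact (ZMod.intCast_eq_intCast_iff_dvd_sub (s i) c q).1 h1

/-- If `supp M` is stable under the string `-A + q ℤ δ`, then weights `μ + N A + K B + s δ` can be
moved, infinitely often with the same `c`, to `μ - A + c δ + N A + K B`. -/
theorem exists_frequently_mem_supp {A B μ : X.CartanDual} {q : ℤ} (hq : 0 < q)
    (hA : ∀ m : ℤ, -A + (q * m) • X.δ ∈ X.setC ρ) {N K : ℕ → ℕ} {s : ℕ → ℤ}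
    (hs : ∀ i, μ + N i • A + K i • B + s i • X.δ ∈ X.supp ρ) :
    ∃ μ' : X.CartanDual, ∀ i₀ : ℕ, ∃ i, i₀ < i ∧ μ' + N i • A + K i • B ∈ X.supp ρ := by
  obtain ⟨c, hc⟩ := exists_residue_frequently s hq
  refine ⟨μ - A + c • X.δ, fun i₀ => ?_⟩
  obtain ⟨i, hi, hlt⟩ := hc.exists_gt i₀
  obtain ⟨m, hm⟩ := hi
  refine ⟨i, hlt, ?_⟩
  -- Adding `-A + q m δ` with `c - s i = q m` replaces `s i • δ` by `c • δ`, at the cost of one `A`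
  -- absorbed into the base point.
  convert (hA m).2 _ (hs i) using 1
  rw [← hm, sub_smul]
  abel

/-- A module whose support is stable under `-A + q ℤ δ` and contains `μ + N A + K B + s δ` for
unboundedly many `K` cannot have finite `B`-strings. -/
theorem notMem_setB_of_frequently {A B μ : X.CartanDual} {q : ℤ} (hq : 0 < q)
    (hA : ∀ m : ℤ, -A + (q * m) • X.δ ∈ X.setC ρ) {N K : ℕ → ℕ} {s : ℕ → ℤ} (hK : StrictMono K)
    (hs : ∀ i, μ + N i • A + K i • B + s i • X.δ ∈ X.supp ρ) : B ∉ X.setB ρ := by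
  intro hB
  obtain ⟨μ', hμ'⟩ := exists_frequently_mem_supp hq hA hs
  have hA0 : -A ∈ X.setC ρ := by simpa using hA 0
  have hμK : ∀ i₀ : ℕ, ∃ i, i₀ < i ∧ μ' + K i • B ∈ X.supp ρ := by
    intro i₀
    obtain ⟨i, hi, h1⟩ := hμ' i₀
    refine ⟨i, hi, ?_⟩
    convert add_nsmul_mem_supp hA0 h1 (N i) using 1
    rw [smul_neg]
    abel
  obtain ⟨j, -, hj⟩ := hμK 0
  -- Seen from the weight `μ' + K j • B`, the `B`-string contains the steps `K i - K j`, which are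
  -- unbounded.
  refine (Set.infinite_of_not_bddAbove ?_) (hB.2 _ hj)
  rintro ⟨b, hb⟩
  obtain ⟨i, hi, h1⟩ := hμK (max j (b + K j))
  have h2 : K j < K i := hK (by omega)
  have h3 : i ≤ K i := hK.id_le i
  have h4 : K i - K j ≤ b := hb ⟨by omega, by
    convert h1 using 1
    rw [add_assoc, ← add_smul]
    congr 2
    omega⟩
  omega

/-- Weights `μ + N A + K B` with unboundedly many `N` and `K` force unbounded multiplicities if the
root vectors of the even real root `A` are locally nilpotent, those of `B` are injective, and `A` and
`B` are orthogonal with `A + B` not a root. -/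
theorem IsRegular.hasUnboundedMultiplicities (hX : X.IsRegular) (hρ : X.IsRep ρ)
    (hfin : X.IsFiniteWeight ρ) {A B μ : X.CartanDual} (hAln : A ∈ X.nilRoots ρ)
    (hA0 : A ∈ X.evenRoots) (hBin : B ∈ X.injRoots ρ) (hAB : X.dualForm B A = 0)
    (hadd : A + B ∉ X.roots)
    {N K : ℕ → ℕ} (hN : StrictMono N) (hK : StrictMono K)
    (hs : ∀ i₀ : ℕ, ∃ i, i₀ < i ∧ μ + N i • A + K i • B ∈ X.supp ρ) :
    X.HasUnboundedMultiplicities ρ := by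
  obtain ⟨p, x, y, hx, hy, h, hx0, hy0, hxne, -, hxA, hyA, hbr, hAh, hBh⟩ :=
    hX.exists_sl2_triple hAln.1.2 hA0
  have hBne : B ≠ 0 := by
    rintro rfl
    exact hBin.1.2 (by rw [hX.dualForm_eq, LinearMap.zero_apply])
  obtain ⟨r, z, hz, j, hzne, hzj, hzB⟩ := hX.exists_parity_homog hBne hBin.1.1
  set e := ρ (homog p x hx) with he
  set f := ρ (homog (-p) y hy) with hf
  set g := ρ (homog r z hz) with hg
  have hxp := homog_mem_affPart (p := p) (hx := hx) hx0
  have hyp := homog_mem_affPart (p := -p) (hx := hy) hy0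
  have hzp := homog_mem_affPart (p := r) (hx := hz) hzj
  have hef : e * f = f * e + ρ h := by rw [hρ.even_mul hxp hyp, hbr]
  have hhe : ρ h * e = e * ρ h + 2 • e := by
    rw [hρ.cartan_mul hxA hxp, hAh, ← Nat.cast_smul_eq_nsmul ℂ 2, Nat.cast_ofNat]
  have hhf : ρ h * f = f * ρ h - 2 • f := by
    rw [hρ.cartan_mul hyA hyp, LinearMap.neg_apply, hAh, ← Nat.cast_smul_eq_nsmul ℂ 2,
      Nat.cast_ofNat, neg_smul, sub_eq_add_neg]
  -- Since `x` is even, the superbracket is a commutator whatever the parity of `z`.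
  have heg : Commute e g := by
    rw [commute_iff_eq, hρ.even_mul hxp hzp, affBr_homog_eq_zero hxA hzB hadd, map_zero, add_zero]
  have hnil : ∀ v, ∃ n, (e ^ n) v = 0 := hAln.2 _ hxA (homog_ne_zero hxne)
  have hginj : Function.Injective g := hBin.2 _ hzB (homog_ne_zero hzne)
  have hfd := hfin.2.2
  obtain ⟨N₀, hN₀⟩ := eventually_ne_natCast (μ h)
  -- Induction on the dimension of a kernel in a weight space. Recording the exponent `D` lets the
  -- next step find a vector that `e ^ D` does not kill.
  have key : ∀ d : ℕ, ∃ i D : ℕ,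
      d ≤ Module.finrank ℂ ↥(X.weightSpace ρ (μ + K i • B) ⊓ LinearMap.ker (e ^ D)) := by
    intro d
    induction d with
    | zero => exact ⟨0, 0, Nat.zero_le _⟩
    | succ d ih =>
      obtain ⟨i, D, hd⟩ := ih
      -- As `i' ≤ N i'`, this makes `N i'` at least `D`, for independence, and at least `N₀`, for
      -- the sl₂ estimate.
      obtain ⟨i', hi', hsupp⟩ := hs (max i (max D N₀))
      have hKi : K i ≤ K i' := hK.monotone (by omega)
      have hNi : i' ≤ N i' := hN.id_le i'
      obtain ⟨w, hw, hw0⟩ := mem_supp_iff.1 hsupp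
      have hwh : ρ h w = (μ h + 2 * (N i' : ℕ)) • w := by
        rw [hw h]
        congr 1
        simp only [LinearMap.add_apply, LinearMap.smul_apply, hAh, hBh B hAB, smul_zero, add_zero,
          nsmul_eq_mul]
        ring
      obtain ⟨a, ha⟩ := exists_e_pow_ne_zero hef hhf hhe hnil hw0 (N i') hwh
        fun m hm => hN₀ m (by omega)
      set v := (f ^ (N i' + a)) ((e ^ a) w) with hv
      have hvw : v ∈ X.weightSpace ρ (μ + K i' • B) := by
        have h1 := hρ.pow_apply_mem_weightSpace hyA hyp
          (hρ.pow_apply_mem_weightSpace hxA hxp hw a) (N i' + a)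
        convert h1 using 2
        rw [smul_neg, add_smul]
        abel
      obtain ⟨E, hE⟩ := hnil v
      have hpow {m n : ℕ} (hmn : m ≤ n) {u : M} (hu : (e ^ m) u = 0) : (e ^ n) u = 0 := by
        rw [← Nat.sub_add_cancel hmn, pow_add, Module.End.mul_apply, hu, map_zero]
      refine ⟨i', max D E, ?_⟩
      set U := X.weightSpace ρ (μ + K i • B) ⊓ LinearMap.ker (e ^ D) with hU
      set V := X.weightSpace ρ (μ + K i' • B) ⊓ LinearMap.ker (e ^ max D E) with hV
      set W := U.map (g ^ (K i' - K i)) with hW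
      have hfdW : FiniteDimensional ℂ (X.weightSpace ρ (μ + K i' • B)) := hfd _
      have hfdV : FiniteDimensional ℂ V := Submodule.finiteDimensional_of_le inf_le_left
      have hginj' : Function.Injective (g ^ (K i' - K i)) := by
        rw [Module.End.coe_pow]
        exact hginj.iterate _
      have hWD : ∀ u ∈ W, (e ^ D) u = 0 := by
        rintro _ ⟨u, hu, rfl⟩
        have h1 := LinearMap.congr_fun (heg.pow_pow D (K i' - K i)).eq u
        rw [Module.End.mul_apply, Module.End.mul_apply, LinearMap.mem_ker.1 hu.2, map_zero] at h1
        exact h1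
      -- The inclusion is strict because `v` lies in `V`, while `e ^ N i'` kills `W` but not `v`.
      have hWV : W < V := by
        refine lt_of_le_of_ne ?_ fun h0 => ?_
        · rintro u hu
          refine ⟨?_, hpow (le_max_left _ _) (hWD u hu)⟩
          obtain ⟨u, hu, rfl⟩ := hu
          have h1 := hρ.pow_apply_mem_weightSpace hzB hzp hu.1 (K i' - K i)
          rwa [add_assoc, ← add_smul, Nat.add_sub_cancel' hKi] at h1
        · have hvW : v ∈ W := h0 ▸ ⟨hvw, hpow (le_max_right _ _) hE⟩
          exact ha (hpow (by omega) (hWD v hvW))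
      have h1 := Submodule.finrank_lt_finrank_of_lt hWV
      have h2 : Module.finrank ℂ W = Module.finrank ℂ U :=
        (LinearEquiv.finrank_eq (Submodule.equivMapOfInjective _ hginj' U)).symm
      omega
  intro d
  obtain ⟨i, D, hd⟩ := key (d + 1)
  have := hfd (μ + K i • B)
  exact ⟨_, lt_of_lt_of_le hd (Submodule.finrank_mono inf_le_left)⟩

end SuperDatum

/-! ### Root strings in direction `δ` and the two assertions of the proposition. -/

namespace SuperDatum

variable {X : SuperDatum} {M : Type*} [AddCommGroup M] [Module ℂ M]
  {ρ : X.Aff →ₗ[ℂ] Module.End ℂ M}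

theorem δ_dElt : X.δ X.dElt = 1 := rfl

theorem δ_cElt : X.δ X.cElt = 0 := rfl

theorem apply_eq_zero_of_mem_span {α : X.CartanDual}
    (hα : α ∈ Submodule.span ℝ X.dotRealRoots) : α X.dElt = 0 ∧ α X.cElt = 0 := by
  induction hα using Submodule.span_induction with
  | mem α hα =>
    rcases hα with rfl | ⟨⟨hd, m, hm⟩, -⟩
    · exact ⟨rfl, rfl⟩
    · refine ⟨hd, ?_⟩
      simpa [δ_cElt] using apply_cElt_of_mem_roots hm
  | zero => exact ⟨rfl, rfl⟩
  | add α β _ _ h1 h2 => simp [h1, h2]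
  | smul a α _ h => simp [h]

theorem add_zsmul_δ_ne_zero {α : X.CartanDual} (hα : α ≠ 0) (hd : α X.dElt = 0) (m : ℤ) :
    α + m • X.δ ≠ 0 := by
  intro h
  have h1 := LinearMap.congr_fun h X.dElt
  simp [hd, δ_dElt] at h1
  rw [h1, zero_smul, add_zero] at h
  exact hα h

/-- By `dualForm_δ`, `δ` is orthogonal to every functional that vanishes at `c`, itself included, so
shifts by `δ` do not affect orthogonality. -/
theorem IsRegular.dualForm_eq_zero (hX : X.IsRegular) {α β : X.CartanDual}
    (hαβ : X.dualForm α β = 0) (hα : α X.cElt = 0) (hβ : β X.cElt = 0) (a b : ℕ) (m l : ℤ) :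
    X.dualForm (a • α + m • X.δ) (b • β + l • X.δ) = 0 := by
  have hadd (γ φ : X.CartanDual) (c : ℕ) (s : ℤ) (h1 : X.dualForm γ φ = 0)
      (h2 : φ X.cElt = 0) : X.dualForm (c • γ + s • X.δ) φ = 0 := by
    rw [← hX.dualForm_δ, hX.dualForm_eq] at h2
    rw [hX.dualForm_eq] at h1 ⊢
    simp [h1, h2]
  refine hadd _ _ _ _ ?_ (by simp [hβ, δ_cElt])
  rw [dualForm_comm]
  exact hadd _ _ _ _ (by rwa [dualForm_comm]) hα

theorem HasShadow.mem_setC_of_notMem_nilRoots (h : X.HasShadow ρ) {γ : X.CartanDual}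
    (hγ : γ ∈ X.realRootsNZ) (hn : γ ∉ X.nilRoots ρ) : γ ∈ X.setC ρ := by
  rw [h.1] at hγ
  exact (h.2.2 ▸ hγ.resolve_right hn : γ ∈ X.setC ρ ∩ X.realRootsNZ).1

theorem HasShadow.mem_setB_of_notMem_injRoots (h : X.HasShadow ρ) {γ : X.CartanDual}
    (hγ : γ ∈ X.realRootsNZ) (hn : γ ∉ X.injRoots ρ) : γ ∈ X.setB ρ := by
  rw [h.1] at hγ
  exact (h.2.1 ▸ hγ.resolve_left hn : γ ∈ X.setB ρ ∩ X.realRootsNZ).1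

theorem HasShadow.injRoots_subset_setC (h : X.HasShadow ρ) : X.injRoots ρ ⊆ X.setC ρ :=
  fun _ hγ => (h.2.2 ▸ hγ : _ ∈ X.setC ρ ∩ X.realRootsNZ).1

theorem IsRegular.neg_mem_realRootsNZ_iff (hX : X.IsRegular) {γ : X.CartanDual} :
    -γ ∈ X.realRootsNZ ↔ γ ∈ X.realRootsNZ :=
  ⟨fun h => neg_neg γ ▸ hX.neg_mem_realRootsNZ h, hX.neg_mem_realRootsNZ⟩

theorem mem_realRootsNZ_of_ne_zero {γ : X.CartanDual} (hγ : γ ∈ X.realRoots) (h0 : γ ≠ 0) :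
    γ ∈ X.realRootsNZ := hγ.resolve_left h0

theorem neg_nsmul_add_zsmul_δ (α : X.CartanDual) (k : ℕ) (r m : ℤ) :
    -(k • α) + (k * r * m) • X.δ = k • (-α + (0 + r * m) • X.δ) := by
  rw [zero_add, smul_add, smul_neg, ← natCast_zsmul, ← natCast_zsmul, smul_smul, mul_assoc]

theorem neg_add_zsmul_δ (β : X.CartanDual) (r m : ℤ) :
    -(2 • β + r • X.δ) + (2 * r * m) • X.δ = -(2 • β) + (-r + 2 * r * m) • X.δ := by
  rw [add_smul, neg_smul]
  abel

/-- The factor 4 in the given weights makes both multiplicities integral: `4 / k` for `kα` and `2`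
for `2β + sδ`. The error is a multiple of `δ`. -/
theorem add_smul_left_eq {α β μ : X.CartanDual} {k k' n : ℕ} (hk : k' * k = 4) (t s : ℤ) :
    μ + (k' * n) • (k • α) + (2 * n) • (2 • β + s • X.δ) + (t - 2 * n * s) • X.δ =
      μ + (4 * n) • (α + β) + t • X.δ := by
  have h1 : k' * n * k = 4 * n := by rw [← hk]; ring
  rw [smul_smul, h1]
  module

theorem add_smul_right_eq {α β μ : X.CartanDual} {k k' n : ℕ} (hk : k' * k = 4) (t r s : ℤ) :
    μ + (2 * n) • (2 • β + r • X.δ) + (k' * n) • (k • (α + s • X.δ)) +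
      (t - 2 * n * r - 4 * n * s) • X.δ = μ + (4 * n) • (α + β) + t • X.δ := by
  have h1 : k' * n * k = 4 * n := by rw [← hk]; ring
  rw [smul_smul, h1]
  module

theorem exists_mul_eq_four {k : ℕ} (hk : k = 1 ∨ k = 2) : ∃ k', 0 < k' ∧ k' * k = 4 := by
  rcases hk with rfl | rfl
  · exact ⟨4, by norm_num⟩
  · exact ⟨2, by norm_num⟩

theorem IsRegular.nilRoots_nonempty_or (hX : X.IsRegular) (hshadow : X.HasShadow ρ)
    {α β μ : X.CartanDual} (hα : α ≠ 0) (hβ : β ≠ 0) (hαd : α X.dElt = 0) (hβd : β X.dElt = 0)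
    {n : ℕ → ℕ} (hn : StrictMono n) {t : ℕ → ℤ}
    (hnt : ∀ i, μ + (4 * n i) • (α + β) + t i • X.δ ∈ X.supp ρ) {r : ℤ} {k : ℕ} (hr : 0 < r)
    (hk : k = 1 ∨ k = 2) (hre : (fun x => k • x) '' X.deltaString (-α) 0 r ∪
      X.deltaString (2 • β) r (2 * r) ⊆ X.realRoots) :
    (((fun x => k • x) '' X.deltaString (-α) 0 r ∩ X.nilRoots ρ).Nonempty ∨
        X.deltaString (2 • β) r (2 * r) ⊆ X.injRoots ρ) ∧
      ((X.deltaString (-(2 • β)) (-r) (2 * r) ∩ X.nilRoots ρ).Nonempty ∨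
        (fun x => k • x) '' X.deltaString α 0 r ⊆ X.injRoots ρ) := by
  have hk0 : k ≠ 0 := by omega
  obtain ⟨k', hk'0, hk'⟩ := exists_mul_eq_four hk
  have hmono (c : ℕ) (hc : 0 < c) : StrictMono fun i => c * n i :=
    fun i j hij => Nat.mul_lt_mul_of_pos_left (hn hij) hc
  have hreα (m : ℤ) : k • (-α + (0 + r * m) • X.δ) ∈ X.realRootsNZ :=
    mem_realRootsNZ_of_ne_zero (hre (Or.inl ⟨_, ⟨m, rfl⟩, rfl⟩)) (smul_ne_zero hk0
      (add_zsmul_δ_ne_zero (neg_ne_zero.2 hα) (by rw [LinearMap.neg_apply, hαd, neg_zero]) _))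
  have hreβ (m : ℤ) : 2 • β + (r + 2 * r * m) • X.δ ∈ X.realRootsNZ :=
    mem_realRootsNZ_of_ne_zero (hre (Or.inr ⟨m, rfl⟩)) (add_zsmul_δ_ne_zero
      (smul_ne_zero two_ne_zero hβ) (by rw [LinearMap.smul_apply, hβd, smul_zero]) _)
  constructor
  · rw [or_iff_not_imp_left]
    rintro hne _ ⟨m, rfl⟩
    by_contra hin
    have hkr : 0 < (k : ℤ) * r := by positivity
    -- The string of `-kα` has step `k * r`, which is the modulus for the pigeonhole.
    refine notMem_setB_of_frequently (A := k • α) hkr (fun m => ?_) (hmono 2 two_pos)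
      (fun i => (add_smul_left_eq hk' (t i) (r + 2 * r * m)).symm ▸ hnt i)
      (hshadow.mem_setB_of_notMem_injRoots (hreβ m) hin)
    rw [neg_nsmul_add_zsmul_δ]
    exact hshadow.mem_setC_of_notMem_nilRoots (hreα m) fun h =>
      hne ⟨_, ⟨_, ⟨m, rfl⟩, rfl⟩, h⟩
  · rw [or_iff_not_imp_left]
    rintro hne _ ⟨_, ⟨m, rfl⟩, rfl⟩
    by_contra hin
    -- The real-root hypothesis covers `-α` and `2β`; the opposite strings needed here follow from
    -- the symmetry of the real roots.
    have hB : k • (α + (0 + r * m) • X.δ) ∈ X.realRootsNZ := by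
      rw [← hX.neg_mem_realRootsNZ_iff, ← smul_neg, neg_add, ← neg_smul,
        show -(0 + r * m) = 0 + r * -m by ring]
      exact hreα (-m)
    -- The roles of the two strings are exchanged: `A = 2β + rδ`, and the string of `-A` has step `2
    -- * r`.
    refine notMem_setB_of_frequently (A := 2 • β + r • X.δ) (q := 2 * r) (by omega) (fun m => ?_)
      (hmono k' hk'0) (fun i => (add_smul_right_eq hk' (t i) r (0 + r * m)).symm ▸ hnt i)
      (hshadow.mem_setB_of_notMem_injRoots hB hin)
    rw [neg_add_zsmul_δ]
    refine hshadow.mem_setC_of_notMem_nilRoots ?_ fun h => hne ⟨_, ⟨m, rfl⟩, h⟩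
    rw [← hX.neg_mem_realRootsNZ_iff, neg_add, neg_neg, ← neg_smul,
      show -(-r + 2 * r * m) = r + 2 * r * -m by ring]
    exact hreβ (-m)

/-- In both cases one string supplies a locally nilpotent `A` whose negative string stabilizes the
support, and the other supplies an injective `B`. Every `A + B` lies in `kα + 2β + ℤδ`, so it is not
a root. -/
theorem IsRegular.hasUnboundedMultiplicities_of_strings (hX : X.IsRegular) (hρ : X.IsRep ρ)
    (hfin : X.IsFiniteWeight ρ) (hshadow : X.HasShadow ρ) {α β μ : X.CartanDual}
    (hαd : α X.dElt = 0) (hβd : β X.dElt = 0) (hαc : α X.cElt = 0) (hβc : β X.cElt = 0)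
    (hαβ : X.dualForm α β = 0) {n : ℕ → ℕ} (hn : StrictMono n) {t : ℕ → ℤ}
    (hnt : ∀ i, μ + (4 * n i) • (α + β) + t i • X.δ ∈ X.supp ρ) {r : ℤ} {k : ℕ} (hr : 0 < r)
    (hk : k = 1 ∨ k = 2) (hadd : k • α + 2 • β ∉ X.dotRoots)
    (hcase : ((fun x => k • x) '' X.deltaString α 0 r ⊆ X.nilRoots ρ ∩ X.evenRoots ∧
        (fun x => k • x) '' X.deltaString (-α) 0 r ⊆ X.injRoots ρ ∩ X.evenRoots ∧
        ∃ m : ℤ, 2 • β + (r + 2 * r * m) • X.δ ∈ X.injRoots ρ) ∨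
      (X.deltaString (2 • β) r (2 * r) ⊆ X.evenRoots ∩ X.nilRoots ρ ∧
        X.deltaString (-(2 • β)) (-r) (2 * r) ⊆ X.evenRoots ∩ X.injRoots ρ ∧
        ∃ m : ℤ, k • (α + (r * m) • X.δ) ∈ X.injRoots ρ)) :
    X.HasUnboundedMultiplicities ρ := by
  obtain ⟨k', hk'0, hk'⟩ := exists_mul_eq_four hk
  have hmono (c : ℕ) (hc : 0 < c) : StrictMono fun i => c * n i :=
    fun i j hij => Nat.mul_lt_mul_of_pos_left (hn hij) hc
  have hnotroot (m : ℤ) : k • α + 2 • β + m • X.δ ∉ X.roots := fun h =>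
    hadd ⟨by simp [hαd, hβd], m, h⟩
  rcases hcase with ⟨hln, hin, m, hm⟩ | ⟨hln, hin, m, hm⟩
  · have hkr : 0 < (k : ℤ) * r := mul_pos (by omega) hr
    -- The member with index zero of the nilpotent string is `A = kα` itself.
    have hA := hln ⟨_, ⟨0, rfl⟩, rfl⟩
    simp only [mul_zero, add_zero, zero_smul] at hA
    obtain ⟨μ', hμ'⟩ := exists_frequently_mem_supp (A := k • α) hkr (fun m => by
      rw [neg_nsmul_add_zsmul_δ]
      exact hshadow.injRoots_subset_setC (hin ⟨_, ⟨m, rfl⟩, rfl⟩).1)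
      (fun i => (add_smul_left_eq hk' (t i) (r + 2 * r * m)).symm ▸ hnt i)
    refine hX.hasUnboundedMultiplicities hρ hfin hA.1 hA.2 hm ?_ ?_ (hmono k' hk'0)
      (hmono 2 two_pos) hμ'
    · have h := hX.dualForm_eq_zero (by rwa [dualForm_comm]) hβc hαc 2 k (r + 2 * r * m) 0
      rwa [zero_smul, add_zero] at h
    · rw [← add_assoc]
      exact hnotroot _
  · have hA := hln ⟨0, rfl⟩
    simp only [mul_zero, add_zero] at hA
    obtain ⟨μ', hμ'⟩ := exists_frequently_mem_supp (A := 2 • β + r • X.δ) (q := 2 * r) (by omega)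
      (fun m => by
        rw [neg_add_zsmul_δ]
        exact hshadow.injRoots_subset_setC (hin ⟨m, rfl⟩).2)
      (fun i => (add_smul_right_eq hk' (t i) r (r * m)).symm ▸ hnt i)
    have hm' : k • (α + (r * m) • X.δ) = k • α + (k * (r * m)) • X.δ := by
      rw [smul_add, ← natCast_zsmul ((r * m) • X.δ), smul_smul]
    rw [hm'] at hm hμ'
    refine hX.hasUnboundedMultiplicities hρ hfin hA.2 hA.1 hm
      (hX.dualForm_eq_zero hαβ hαc hβc k 2 _ r) ?_ (hmono 2 two_pos) (hmono k' hk'0) hμ'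
    have heq : 2 • β + r • X.δ + (k • α + (k * (r * m)) • X.δ) =
        k • α + 2 • β + (r + k * (r * m)) • X.δ := by
      rw [add_smul r]
      abel
    rw [heq]
    exact hnotroot _

end SuperDatum

theorem proposition3p4 (T : TwistedType) {M : Type*} [AddCommGroup M] [Module ℂ M]
    (ρ : T.datum.Aff →ₗ[ℂ] Module.End ℂ M) (hρ : T.datum.IsRep ρ)
    (hfin : T.datum.IsFiniteWeight ρ) (hshadow : T.datum.HasShadow ρ)
    (α β : T.datum.CartanDual) (hα : α ≠ 0) (hβ : β ≠ 0)
    (hα_span : α ∈ Submodule.span ℝ T.datum.dotRealRoots)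
    (hβ_span : β ∈ Submodule.span ℝ T.datum.dotRealRoots)
    (hαβ : T.datum.dualForm α β = 0)
    (μ : T.datum.CartanDual) (hμ : μ ∈ T.datum.supp ρ)
    (n : ℕ → ℕ) (hn_pos : ∀ i, 0 < n i) (hn : StrictMono n) (t : ℕ → ℤ)
    (hnt : ∀ i, μ + (4 * n i) • (α + β) + t i • T.datum.δ ∈ T.datum.supp ρ) :
    (∀ (r : ℤ) (k : ℕ), 0 < r → k = 1 ∨ k = 2 →
      (fun x => k • x) '' T.datum.deltaString (-α) 0 r ∪
          T.datum.deltaString (2 • β) r (2 * r) ⊆ T.datum.realRoots →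
      (((fun x => k • x) '' T.datum.deltaString (-α) 0 r ∩ T.datum.nilRoots ρ).Nonempty ∨
          T.datum.deltaString (2 • β) r (2 * r) ⊆ T.datum.injRoots ρ) ∧
        ((T.datum.deltaString (-(2 • β)) (-r) (2 * r) ∩ T.datum.nilRoots ρ).Nonempty ∨
          (fun x => k • x) '' T.datum.deltaString α 0 r ⊆ T.datum.injRoots ρ)) ∧
    (∀ (r : ℤ) (k : ℕ), 0 < r → k = 1 ∨ k = 2 →
      k • α + 2 • β ∉ T.datum.dotRoots → k • α - 2 • β ∉ T.datum.dotRoots →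
      ((fun x => k • x) '' T.datum.deltaString α 0 r ⊆ T.datum.nilRoots ρ ∩ T.datum.evenRoots ∧
          (fun x => k • x) '' T.datum.deltaString (-α) 0 r ⊆
            T.datum.injRoots ρ ∩ T.datum.evenRoots ∧
          ∃ m : ℤ, 2 • β + (r + 2 * r * m) • T.datum.δ ∈ T.datum.injRoots ρ) ∨
        (T.datum.deltaString (2 • β) r (2 * r) ⊆ T.datum.evenRoots ∩ T.datum.nilRoots ρ ∧
          T.datum.deltaString (-(2 • β)) (-r) (2 * r) ⊆
            T.datum.evenRoots ∩ T.datum.injRoots ρ ∧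
          ∃ m : ℤ, k • (α + (r * m) • T.datum.δ) ∈ T.datum.injRoots ρ) →
      T.datum.HasUnboundedMultiplicities ρ) := by
  have hX := T.datum_isRegular
  obtain ⟨hαd, hαc⟩ := SuperDatum.apply_eq_zero_of_mem_span hα_span
  obtain ⟨hβd, hβc⟩ := SuperDatum.apply_eq_zero_of_mem_span hβ_span
  exact ⟨fun r k hr hk hre => hX.nilRoots_nonempty_or hshadow hα hβ hαd hβd hn hnt hr hk hre,
    fun r k hr hk hadd _ hcase => hX.hasUnboundedMultiplicities_of_strings hρ hfin hshadow hαd hβd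
      hαc hβc hαβ hn hnt hr hk hadd hcase⟩
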